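/- For $n\ge 0$ let $e_1,\dots,e_n$ be the standard basis of $\mathbb R^n$ and consider the positive roots of the classical root systems $$A_{n-1}^+=\{e_i-e_j: 1\le i<j\le n\},\qquad D_n^+=\{e_i-e_j,\ e_i+e_j: 1\le i<j\le n\},$$ $$B_n^+=D_n^+\cup\{e_i:1\le i\le n\},\qquad C_n^+=D_n^+\cup\{2e_i:1\le i\le n\}.$$ For $\Phi\in\{A_{n-1},B_n,C_n,D_n\}$ let $\Pi^{\mathbb Z}(\Phi)=\sum_{\alpha\in\Phi^+}[0,\alpha]\subset\mathbb R^n$ (Minkowski sum of segments, equal to $\{0\}$ if $\Phi^+=\emptyset$) be the integral Coxeter permutahedron. There is a unique polynomial $\mathrm{ehr}_{\Pi^{\mathbb Z}(\Phi)}\in\mathbb Q[t]$, the Ehrhart polynomial, with $\mathrm{ehr}_{\Pi^{\mathbb Z}(\Phi)}(t)=|t\,\Pi^{\mathbb Z}(\Phi)\cap\mathbb Z^n|$ for every positive integer $t$. Let $W(x)=\sum_{n\ge1}(-n)^{n-1}\frac{x^n}{n!}$ be the Lambert $W$ function. Then, for every rational number $t\neq0$ (in particular for every positive integer $t$), the following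 identities of formal power series in $x$ over $\mathbb Q$ hold, where $\sqrt{1+f}$ denotes the square root with constant term $1$: $$\sum_{n\ge0}\mathrm{ehr}_{\Pi^{\mathbb Z}(A_{n-1})}(t)\frac{x^n}{n!}=\exp\Big(-\frac1tW(-tx)-\frac1{2t}W(-tx)^2\Big),$$ $$\sum_{n\ge0}\mathrm{ehr}_{\Pi^{\mathbb Z}(B_n)}(t)\frac{x^n}{n!}=\frac{\exp\big(-\frac1{2t}W(-2tx)-\frac1{4t}W(-2tx)^2\big)}{\sqrt{1+W(-2tx)}},$$ $$\sum_{n\ge0}\mathrm{ehr}_{\Pi^{\mathbb Z}(C_n)}(t)\frac{x^n}{n!}=\frac{\exp\big(\frac{-t-1}{2t}W(-2tx)-\frac1{4t}W(-2tx)^2\big)}{\sqrt{1+W(-2tx)}},$$ $$\sum_{n\ge0}\mathrm{ehr}_{\Pi^{\mathbb Z}(D_n)}(t)\frac{x^n}{n!}=\frac{\exp\big(\frac{t-1}{2t}W(-2tx)-\frac1{4t}W(-2tx)^2\big)}{\sqrt{1+W(-2tx)}}.$$ -/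

import Mathlib

open scoped Pointwise Nat

/-! ## Positive roots of the classical root systems, as vectors in `ℤ ^ n` -/

/-- Positive roots of `A_{n-1}`: the vectors `e_i - e_j` with `i < j`. -/
def positiveRootsA (n : ℕ) : Finset (Fin n → ℤ) :=
  ((Finset.univ : Finset (Fin n × Fin n)).filter fun p => p.1 < p.2).image
    fun p => Pi.single p.1 1 - Pi.single p.2 1

/-- Positive roots of `D_n`: the vectors `e_i - e_j` and `e_i + e_j` with `i < j`. -/
def positiveRootsD (n : ℕ) : Finset (Fin n → ℤ) :=
  positiveRootsA n ∪
    ((Finset.univ : Finset (Fin n × Fin n)).filter fun p => p.1 < p.2).image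
      fun p => Pi.single p.1 1 + Pi.single p.2 1

/-- Positive roots of `B_n`: those of `D_n` together with the vectors `e_i`. -/
def positiveRootsB (n : ℕ) : Finset (Fin n → ℤ) :=
  positiveRootsD n ∪ (Finset.univ : Finset (Fin n)).image fun i => Pi.single i 1

/-- Positive roots of `C_n`: those of `D_n` together with the vectors `2 e_i`. -/
def positiveRootsC (n : ℕ) : Finset (Fin n → ℤ) :=
  positiveRootsD n ∪ (Finset.univ : Finset (Fin n)).image fun i => Pi.single i 2

/-! ## Integral Coxeter permutahedra and Ehrhart polynomials -/

/-- The inclusion of `ℤ ^ n` in `ℝ ^ n`. -/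
def intVec {n : ℕ} (z : Fin n → ℤ) : Fin n → ℝ := fun i => (z i : ℝ)

/-- The integral Coxeter permutahedron with positive roots `Φ`: the Minkowski sum of the segments
`[0, α]` over `α ∈ Φ` (the single point `0` when `Φ` is empty). -/
noncomputable def integralCoxeterPermutahedron {n : ℕ} (Φ : Finset (Fin n → ℤ)) :
    Set (Fin n → ℝ) :=
  ∑ α ∈ Φ, segment ℝ 0 (intVec α)

/-- The lattice points of the dilate `t P`. -/
def dilateLatticePoints {n : ℕ} (P : Set (Fin n → ℝ)) (t : ℕ) : Set (Fin n → ℤ) :=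
  {z | intVec z ∈ (t : ℝ) • P}

/-- `p` is the Ehrhart polynomial of `P`: for every positive integer `t`, the dilate `t P` contains
exactly `p(t)` lattice points. Such a `p` is unique, having prescribed values at infinitely many
arguments. -/
def IsEhrhartPolynomial {n : ℕ} (P : Set (Fin n → ℝ)) (p : Polynomial ℚ) : Prop :=
  ∀ t : ℕ, 0 < t →
    (dilateLatticePoints P t).Finite ∧ ((dilateLatticePoints P t).ncard : ℚ) = p.eval (t : ℚ)

/-! ## Formal power series in `x` over `ℚ` -/

/-- The Lambert function `W(x) = ∑_{n ≥ 1} (-n)^(n-1) x^n / n!`. -/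
noncomputable def lambertW : PowerSeries ℚ :=
  PowerSeries.mk fun n => if n = 0 then 0 else (-(n : ℚ)) ^ (n - 1) / (n ! : ℚ)

/-- `W(c x)` for a scalar `c`. -/
noncomputable def lambertWScaled (c : ℚ) : PowerSeries ℚ :=
  PowerSeries.rescale c lambertW

/-- `exp(f)` for a power series `f` without constant term. -/
noncomputable def expSeries (f : PowerSeries ℚ) : PowerSeries ℚ :=
  (PowerSeries.exp ℚ).subst f

/-- `√(1 + f)` for a power series `f` without constant term: Newton's binomial series
`∑ₖ (1/2 choose k) f^k`. -/
noncomputable def sqrtOneAdd (f : PowerSeries ℚ) : PowerSeries ℚ :=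
  (PowerSeries.binomialSeries ℚ (1 / 2 : ℚ)).subst f

/-- `sqrtOneAdd f` is indeed a square root of `1 + f`. -/
theorem sqrtOneAdd_sq (f : PowerSeries ℚ) (hf : PowerSeries.constantCoeff f = 0) :
    sqrtOneAdd f ^ 2 = 1 + f := by
  have h : PowerSeries.HasSubst f := PowerSeries.HasSubst.of_constantCoeff_zero' hf
  have key : PowerSeries.binomialSeries ℚ (1 / 2 : ℚ) ^ 2 = 1 + PowerSeries.X := by
    rw [sq, ← PowerSeries.binomialSeries_add]
    have := PowerSeries.binomialSeries_nat (R := ℚ) (A := ℚ) 1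
    norm_num at this ⊢
    exact this
  rw [sqrtOneAdd, ← PowerSeries.subst_pow h, key, PowerSeries.subst_add h, PowerSeries.subst_X h,
    ← PowerSeries.coe_substAlgHom h, map_one]

/-- The exponential generating function `∑_{n ≥ 0} p_n(t) x^n / n!` of a sequence of polynomials
`p_n`, evaluated at a number `t`. -/
noncomputable def egfAt (p : ℕ → Polynomial ℚ) (t : ℚ) : PowerSeries ℚ :=
  PowerSeries.mk fun n => (p n).eval t / (n ! : ℚ)

/-! The engine is deletion and contraction of a segment. If an integral vector `β` has a coordinate
equal to 1, the fibres of a convex body `P` along `β` are compact intervals, and adding `[0, β]`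
lengthens each by exactly 1. Over every lattice point of the projection of `P` along `β` this gains
exactly one lattice point, so `P + [0, β]` has as many lattice points as `P` and its projection
together (`latticeCount_add_segBody`). Lattice translations do not affect counts, so everything
happens in the monoid of convex bodies modulo them, where `[0, v]` and `[0, -v]` coincide.

A sum of root segments is read as a complete graph (type A) or a signed complete graph with half
edges (types B, C, D). Expanding all edges at one vertex `s` sums over the set of neighbours merged
into `s` (`classCount_add_sum_star`); after merging `k` neighbours, `s` is joined to each remaining
vertex with multiplicity `k`. This yields recursions on the number of vertices and the multiplicity
at `s`, with the number `h` of half edges per vertex as a further parameter for B, C, D. They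
determine the counts (`IsTypeARecursion.classCount_eq`, `IsTypeBRecursion.classCount_eq`).

For exponential generating functions, such binomial sums are products with `exp(c x u)`. With `w = t
x exp(w)`, a vertex of multiplicity `a` contributes `exp(a w)` in type A, and the remaining equation
`F' = exp(w) F` integrates to the stated exponential. In types B, C, D one takes `w = 2 t x exp(w)`,
and the factor is `exp(a w) (1 + a α + a² β)`. Counting rooted forests identifies `w` with `-W(-t
x)`, respectively `-W(-2 t x)`.

The closed forms satisfy the recursions for every rational `t ≠ 0`, and the recursions show that
their coefficients are polynomial in `t`. These polynomials are the Ehrhart polynomials. -/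

/-! ## Lattice points of convex bodies up to lattice translation -/

/-- The number of lattice points of a set. -/
noncomputable def latticeCount {n : ℕ} (P : Set (Fin n → ℝ)) : ℕ :=
  {z : Fin n → ℤ | intVec z ∈ P}.ncard

theorem intVec_add {n : ℕ} (x y : Fin n → ℤ) : intVec (x + y) = intVec x + intVec y := by
  ext; simp [intVec]

theorem intVec_zero {n : ℕ} : intVec (0 : Fin n → ℤ) = 0 := by
  ext; simp [intVec]

theorem intVec_neg {n : ℕ} (x : Fin n → ℤ) : intVec (-x) = -intVec x := by
  ext; simp [intVec]

theorem intVec_sub {n : ℕ} (x y : Fin n → ℤ) : intVec (x - y) = intVec x - intVec y := by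
  ext; simp [intVec]

theorem intVec_smul {n : ℕ} (k : ℤ) (x : Fin n → ℤ) : intVec (k • x) = (k : ℝ) • intVec x := by
  ext; simp [intVec]

theorem intVec_injective {n : ℕ} : Function.Injective (intVec (n := n)) := fun x y h => by
  ext i
  have := congrFun h i
  simpa [intVec] using this

theorem finite_latticePoints {n : ℕ} {P : Set (Fin n → ℝ)} (hP : Bornology.IsBounded P) :
    {z : Fin n → ℤ | intVec z ∈ P}.Finite := by
  obtain ⟨r, hr⟩ := hP.subset_closedBall 0
  refine (Set.Finite.pi' (t := fun _ : Fin n => Set.Icc (-⌈r⌉) ⌈r⌉)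
    fun _ => Set.finite_Icc _ _).subset fun z hz i => ?_
  have h1 := hr hz
  rw [mem_closedBall_zero_iff] at h1
  have h2 : |(z i : ℝ)| ≤ r := (norm_le_pi_norm (intVec z) i).trans h1
  have h3 := abs_le.1 (h2.trans (Int.le_ceil r))
  exact ⟨by exact_mod_cast h3.1, by exact_mod_cast h3.2⟩

theorem latticeCount_translate {n : ℕ} (z : Fin n → ℤ) (P : Set (Fin n → ℝ)) :
    latticeCount ({intVec z} + P) = latticeCount P := by
  refine (Set.ncard_congr (fun x _ => z + x) (fun x hx => ?_) (fun x y _ _ h => add_left_cancel h)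
    fun y hy => ?_).symm
  · exact ⟨_, rfl, _, hx, (intVec_add z x).symm⟩
  · obtain ⟨_, rfl, p, hp, h⟩ := hy
    refine ⟨y - z, ?_, by simp⟩
    have : intVec (y - z) = p := by rw [intVec_sub, ← h]; simp
    simpa [this] using hp

/-- Two convex bodies are equivalent if they differ by a lattice translation. -/
def latticeTranslationCon (n : ℕ) : AddCon (ConvexBody (Fin n → ℝ)) where
  r P Q := ∃ z : Fin n → ℤ, (P : Set (Fin n → ℝ)) = {intVec z} + (Q : Set (Fin n → ℝ))
  iseqv :=
    { refl := fun P => ⟨0, by simp [intVec_zero]⟩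
      symm := by
        rintro P Q ⟨z, h⟩
        exact ⟨-z, by rw [h, ← add_assoc, Set.singleton_add_singleton, ← intVec_add]
                      simp [intVec_zero]⟩
      trans := by
        rintro P Q R ⟨z, h⟩ ⟨z', h'⟩
        exact ⟨z + z', by rw [h, h', ← add_assoc, Set.singleton_add_singleton, ← intVec_add]⟩ }
  add' := by
    rintro P P' Q Q' ⟨z, h⟩ ⟨z', h'⟩
    exact ⟨z + z', by
      rw [ConvexBody.coe_add, ConvexBody.coe_add, h, h', intVec_add, ← Set.singleton_add_singleton]
      exact add_add_add_comm _ _ _ _⟩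

/-- Convex bodies modulo lattice translations, a commutative monoid under Minkowski addition. -/
def BodyClass (n : ℕ) : Type := (latticeTranslationCon n).Quotient

noncomputable instance (n : ℕ) : AddCommMonoid (BodyClass n) :=
  inferInstanceAs (AddCommMonoid (latticeTranslationCon n).Quotient)

/-- The class of a convex body. -/
noncomputable def bodyClass {n : ℕ} : ConvexBody (Fin n → ℝ) →+ BodyClass n := (latticeTranslationCon n).mk'

theorem bodyClass_eq_iff {n : ℕ} {P Q : ConvexBody (Fin n → ℝ)} :
    bodyClass P = bodyClass Q ↔
      ∃ z : Fin n → ℤ, (P : Set (Fin n → ℝ)) = {intVec z} + (Q : Set (Fin n → ℝ)) :=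
  (latticeTranslationCon n).eq

theorem bodyClass_surjective {n : ℕ} : Function.Surjective (bodyClass (n := n)) :=
  AddCon.mk'_surjective

/-- The number of lattice points of a class of convex bodies. -/
noncomputable def classCount {n : ℕ} (p : BodyClass n) : ℕ :=
  AddCon.liftOn p (fun P => latticeCount (P : Set (Fin n → ℝ))) (by
    rintro P Q ⟨z, h⟩
    rw [h, latticeCount_translate])

theorem classCount_bodyClass {n : ℕ} (P : ConvexBody (Fin n → ℝ)) :
    classCount (bodyClass P) = latticeCount (P : Set (Fin n → ℝ)) := rfl

theorem classCount_zero {n : ℕ} : classCount (0 : BodyClass n) = 1 := by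
  rw [← map_zero bodyClass, classCount_bodyClass, latticeCount, Set.ncard_eq_one]
  refine ⟨0, ?_⟩
  ext z
  rw [ConvexBody.coe_zero]
  simp only [Set.mem_ofPred_eq, Set.mem_zero, Set.mem_singleton_iff]
  exact ⟨fun h => intVec_injective (h.trans intVec_zero.symm), fun h => h ▸ intVec_zero⟩

/-- The segment from the origin to a lattice point. -/
def segBody {n : ℕ} (v : Fin n → ℤ) : ConvexBody (Fin n → ℝ) where
  carrier := segment ℝ 0 (intVec v)
  convex' := convex_segment _ _
  isCompact' := by
    rw [segment_eq_image]
    exact isCompact_Icc.image (by fun_prop)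
  nonempty' := ⟨0, left_mem_segment _ _ _⟩

theorem coe_segBody {n : ℕ} (v : Fin n → ℤ) :
    (segBody v : Set (Fin n → ℝ)) = segment ℝ 0 (intVec v) := rfl

/-- The class of the segment from the origin to a lattice point. -/
noncomputable def seg {n : ℕ} (v : Fin n → ℤ) : BodyClass n := bodyClass (segBody v)

theorem seg_zero {n : ℕ} : seg (0 : Fin n → ℤ) = 0 := by
  rw [seg, ← map_zero bodyClass]
  congr 1
  apply ConvexBody.ext
  rw [coe_segBody, intVec_zero, segment_same, ConvexBody.coe_zero]
  rfl

/-- The two segments differ by the lattice translation by `v`; this is what makes edges unoriented.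
-/
theorem seg_neg {n : ℕ} (v : Fin n → ℤ) : seg (-v) = seg v := by
  refine bodyClass_eq_iff.2 ⟨-v, ?_⟩
  rw [coe_segBody, coe_segBody, Set.singleton_add, segment_translate_image]
  rw [segment_symm, intVec_neg]
  simp

/-- By convexity `2 [0, v] = [0, v] + [0, v]`. Long roots `2 e_i`, and the edges that become `2 e_s`
after a contraction, thus count as two half edges. -/
theorem seg_two_smul {n : ℕ} (v : Fin n → ℤ) : seg ((2 : ℤ) • v) = 2 • seg v := by
  rw [seg, seg, ← map_nsmul]
  congr 1
  apply ConvexBody.ext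
  have h := Convex.add_smul (segBody v).convex (zero_le_one (α := ℝ)) (zero_le_one (α := ℝ))
  rw [two_nsmul, ConvexBody.coe_add]
  rw [one_smul] at h
  rw [← h, coe_segBody, coe_segBody, intVec_smul]
  have := image_segment ℝ (LinearMap.toAffineMap (LinearMap.lsmul ℝ (Fin n → ℝ) 2)) 0 (intVec v)
  simp at this
  rw [← Set.image_smul]
  norm_num
  exact this.symm

/-- The real linear map with prescribed integral values on the standard basis. -/
noncomputable def realLin {n : ℕ} (g : Fin n → Fin n → ℤ) : (Fin n → ℝ) →ₗ[ℝ] (Fin n → ℝ) :=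
  Fintype.linearCombination ℝ fun j => intVec (g j)

/-- The integral linear map with prescribed values on the standard basis. -/
def intLin {n : ℕ} (g : Fin n → Fin n → ℤ) : (Fin n → ℤ) →ₗ[ℤ] (Fin n → ℤ) :=
  Fintype.linearCombination ℤ g

theorem realLin_intVec {n : ℕ} (g : Fin n → Fin n → ℤ) (v : Fin n → ℤ) :
    realLin g (intVec v) = intVec (intLin g v) := by
  ext i
  simp [realLin, intLin, Fintype.linearCombination_apply, intVec]

theorem intLin_single {n : ℕ} (g : Fin n → Fin n → ℤ) (j : Fin n) :
    intLin g (Pi.single j 1) = g j := by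
  simp [intLin]

theorem realLin_comp {n : ℕ} (g g' : Fin n → Fin n → ℤ) (x : Fin n → ℝ) :
    realLin g (realLin g' x) = realLin (fun j => intLin g (g' j)) x := by
  have : (realLin g).comp (realLin g') = realLin (fun j => intLin g (g' j)) := by
    refine LinearMap.pi_ext' fun j => LinearMap.ext_ring ?_
    simp only [LinearMap.comp_apply, LinearMap.single_apply]
    simp only [realLin, Fintype.linearCombination_apply_single, one_smul]
    exact realLin_intVec g (g' j)
  exact LinearMap.congr_fun this x

/-- The image of a convex body under a linear map that is integral on the lattice. -/
noncomputable def mapBody {n : ℕ} (g : Fin n → Fin n → ℤ) :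
    ConvexBody (Fin n → ℝ) →+ ConvexBody (Fin n → ℝ) where
  toFun P :=
    { carrier := realLin g '' P
      convex' := P.convex.linear_image _
      isCompact' := P.isCompact.image (LinearMap.continuous_of_finiteDimensional _)
      nonempty' := P.nonempty.image _ }
  map_zero' := ConvexBody.ext (by
    change realLin g '' _ = _
    rw [ConvexBody.coe_zero, Set.image_zero, map_zero]; rfl)
  map_add' P Q := ConvexBody.ext (by
    change realLin g '' ((P + Q : ConvexBody (Fin n → ℝ)) : Set (Fin n → ℝ)) = _
    rw [ConvexBody.coe_add, ConvexBody.coe_add, Set.image_add]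
    rfl)

theorem coe_mapBody {n : ℕ} (g : Fin n → Fin n → ℤ) (P : ConvexBody (Fin n → ℝ)) :
    (mapBody g P : Set (Fin n → ℝ)) = realLin g '' P := rfl

/-- The action of integral linear maps on classes of convex bodies. -/
noncomputable def mapClass {n : ℕ} (g : Fin n → Fin n → ℤ) : BodyClass n →+ BodyClass n :=
  (latticeTranslationCon n).lift (bodyClass.comp (mapBody g)) (by
    rintro P Q ⟨z, h⟩
    refine bodyClass_eq_iff.2 ⟨intLin g z, ?_⟩
    rw [coe_mapBody, coe_mapBody, h, Set.image_add, Set.image_singleton, realLin_intVec])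

theorem mapClass_bodyClass {n : ℕ} (g : Fin n → Fin n → ℤ) (P : ConvexBody (Fin n → ℝ)) :
    mapClass g (bodyClass P) = bodyClass (mapBody g P) := rfl

theorem mapClass_seg {n : ℕ} (g : Fin n → Fin n → ℤ) (v : Fin n → ℤ) :
    mapClass g (seg v) = seg (intLin g v) := by
  rw [seg, mapClass_bodyClass, seg]
  congr 1
  apply ConvexBody.ext
  rw [coe_mapBody, coe_segBody, coe_segBody, ← realLin_intVec]
  have := image_segment ℝ (LinearMap.toAffineMap (realLin g)) 0 (intVec v)
  simpa using this

theorem mapClass_mapClass {n : ℕ} (g g' : Fin n → Fin n → ℤ) (p : BodyClass n) :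
    mapClass g (mapClass g' p) = mapClass (fun j => intLin g (g' j)) p := by
  obtain ⟨P, rfl⟩ := bodyClass_surjective p
  rw [mapClass_bodyClass, mapClass_bodyClass, mapClass_bodyClass]
  congr 1
  apply ConvexBody.ext
  simp only [coe_mapBody, Set.image_image, realLin_comp]

/-! ## Deletion and contraction of a segment -/

/-- The projection `x ↦ x - x i • β` along `β`, on the standard basis. -/
def contractAlong {n : ℕ} (i : Fin n) (β : Fin n → ℤ) (j : Fin n) : Fin n → ℤ :=
  Pi.single j 1 - if j = i then β else 0

theorem intLin_contractAlong {n : ℕ} (i : Fin n) (β x : Fin n → ℤ) :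
    intLin (contractAlong i β) x = x - x i • β := by
  simp only [intLin, Fintype.linearCombination_apply, contractAlong, smul_sub,
    Finset.sum_sub_distrib, smul_ite, smul_zero, Finset.sum_ite_eq', Finset.mem_univ, if_true]
  congr 1
  ext k
  simp [Finset.sum_apply, Pi.single_apply]

theorem realLin_contractAlong {n : ℕ} (i : Fin n) (β : Fin n → ℤ) (x : Fin n → ℝ) :
    realLin (contractAlong i β) x = x - x i • intVec β := by
  have h : ∀ j, intVec (contractAlong i β j)
      = Pi.single j 1 - if j = i then intVec β else 0 := by
    intro j
    rw [contractAlong, intVec_sub]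
    congr 1
    · ext k; simp [intVec, Pi.single_apply]
    · split_ifs <;> simp [intVec_zero]
  simp only [realLin, Fintype.linearCombination_apply, h, smul_sub,
    Finset.sum_sub_distrib, smul_ite, smul_zero, Finset.sum_ite_eq', Finset.mem_univ, if_true]
  congr 1
  ext k
  simp [Finset.sum_apply, Pi.single_apply]

theorem exists_preimage_line_eq_Icc {n : ℕ} (P : ConvexBody (Fin n → ℝ)) (q v : Fin n → ℝ)
    {i : Fin n} (hv : v i = 1) (hne : ∃ r : ℝ, q + r • v ∈ P) :
    ∃ a b : ℝ, a ≤ b ∧ ∀ r : ℝ, q + r • v ∈ P ↔ a ≤ r ∧ r ≤ b := by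
  set K : Set ℝ := {r | q + r • v ∈ P} with hK
  have hne' : K.Nonempty := hne
  have hcl : IsClosed K := P.isClosed.preimage (by fun_prop)
  have hconv : Convex ℝ K := by
    have := P.convex.affine_preimage (AffineMap.lineMap q (q + v) : ℝ →ᵃ[ℝ] (Fin n → ℝ))
    have h : K = (AffineMap.lineMap q (q + v) : ℝ →ᵃ[ℝ] (Fin n → ℝ)) ⁻¹' P := by
      ext r
      change q + r • v ∈ P ↔ AffineMap.lineMap q (q + v) r ∈ P
      rw [AffineMap.lineMap_apply_module', add_sub_cancel_left, add_comm]
    rwa [h]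
  -- Since `v i = 1`, the `i`-th coordinate along the line is `q i + r`, so a bound on `P` bounds
  -- `r`.
  have hbd : Bornology.IsBounded K := by
    obtain ⟨c, hc⟩ := P.isBounded.subset_closedBall 0
    refine (Metric.isBounded_closedBall (x := -q i) (r := c)).subset fun r hr => ?_
    have h1 := hc hr
    rw [mem_closedBall_zero_iff] at h1
    have h2 := (norm_le_pi_norm _ i).trans h1
    rw [Metric.mem_closedBall, dist_eq_norm]
    simpa [hv, add_comm] using h2
  have hcomp : IsCompact K := Metric.isCompact_of_isClosed_isBounded hcl hbd
  have h := eq_Icc_of_connected_compact ⟨hne', hconv.isPreconnected⟩ hcomp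
  refine ⟨sInf K, sSup K, Real.sInf_le_sSup K hcomp.bddBelow hcomp.bddAbove, fun r => ?_⟩
  rw [← Set.mem_Icc, ← h]
  rfl

theorem add_segment_mem_iff {n : ℕ} {P : Set (Fin n → ℝ)} {q v : Fin n → ℝ} {a b : ℝ} (hab : a ≤ b)
    (h : ∀ r : ℝ, q + r • v ∈ P ↔ a ≤ r ∧ r ≤ b) (r : ℝ) :
    q + r • v ∈ P + segment ℝ 0 v ↔ a ≤ r ∧ r ≤ b + 1 := by
  simp only [Set.mem_add, segment_eq_image, smul_zero, zero_add, Set.mem_image]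
  constructor
  · rintro ⟨x, hx, _, ⟨c, hc, rfl⟩, hxy⟩
    have hx' : x = q + (r - c) • v := by rw [eq_sub_of_add_eq hxy]; module
    rw [hx', h] at hx
    exact ⟨by linarith [hc.1], by linarith [hc.2]⟩
  · rintro ⟨h1, h2⟩
    refine ⟨q + (min r b) • v, (h _).2 ⟨le_min h1 hab, min_le_right _ _⟩, _,
      ⟨r - min r b, ⟨by simp, ?_⟩, rfl⟩, by module⟩
    rcases min_choice r b with h | h <;> rw [h] <;> linarith

/-- The condition `β i = 1` makes `β` primitive and lets the `i`-th coordinate parametrise the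
lattice points of the line, starting from its point `q` with `q i = 0`. -/
theorem card_filter_line {n : ℕ} (S : Finset (Fin n → ℤ)) (i : Fin n) {β q : Fin n → ℤ}
    (hβ : β i = 1) (hq : q i = 0) {a b : ℝ}
    (h : ∀ r : ℤ, q + r • β ∈ S ↔ a ≤ r ∧ (r : ℝ) ≤ b) :
    (S.filter fun z => z - z i • β = q).card = (Finset.Icc ⌈a⌉ ⌊b⌋).card := by
  refine Finset.card_bij' (fun z _ => z i) (fun r _ => q + r • β) ?_ ?_ ?_ ?_
  · intro z hz
    rw [Finset.mem_filter] at hz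
    have : z = q + z i • β := by rw [← hz.2]; simp
    have h1 := hz.1
    rw [this, h] at h1
    rw [Finset.mem_Icc, Int.ceil_le, Int.le_floor]
    exact h1
  · intro r hr
    rw [Finset.mem_Icc, Int.ceil_le, Int.le_floor] at hr
    rw [Finset.mem_filter]
    exact ⟨(h r).2 hr, by simp [hβ, hq]⟩
  · intro z hz
    rw [Finset.mem_filter] at hz
    rw [← hz.2]; simp
  · intro r _
    simp [hβ, hq]

theorem latticeCount_eq_card_toFinset {n : ℕ} (P : ConvexBody (Fin n → ℝ)) :
    latticeCount (P : Set (Fin n → ℝ)) = (finite_latticePoints P.isBounded).toFinset.card :=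
  Set.ncard_eq_toFinset_card _ _

/-- Both `P` and `P + [0, β]` are fibred over the lattice points of the same projection of `P`. Over
each of them the fibre changes from a nonempty interval `[a, b]` to `[a, b + 1]`, which contains
exactly one more integer. -/
theorem latticeCount_add_segBody {n : ℕ} (P : ConvexBody (Fin n → ℝ)) {i : Fin n} {β : Fin n → ℤ}
    (hβ : β i = 1) :
    latticeCount ((P + segBody β : ConvexBody (Fin n → ℝ)) : Set (Fin n → ℝ)) =
      latticeCount (P : Set (Fin n → ℝ)) +
        latticeCount (mapBody (contractAlong i β) P : Set (Fin n → ℝ)) := by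
  have hβ' : intVec β i = 1 := by simp [intVec, hβ]
  rw [latticeCount_eq_card_toFinset, latticeCount_eq_card_toFinset, latticeCount_eq_card_toFinset]
  set S' := (finite_latticePoints (P + segBody β).isBounded).toFinset with hS'
  set S := (finite_latticePoints P.isBounded).toFinset with hS
  set T := (finite_latticePoints (mapBody (contractAlong i β) P).isBounded).toFinset with hT
  have memS' : ∀ z, z ∈ S' ↔ intVec z ∈ (P : Set (Fin n → ℝ)) + segment ℝ 0 (intVec β) := by
    intro z; rw [hS', Set.Finite.mem_toFinset, ConvexBody.coe_add]; rfl
  have memS : ∀ z, z ∈ S ↔ intVec z ∈ P := by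
    intro z; rw [hS, Set.Finite.mem_toFinset]; rfl
  have memT : ∀ z, z ∈ T ↔ ∃ x ∈ P, x - x i • intVec β = intVec z := by
    intro z
    rw [hT, Set.Finite.mem_toFinset]
    simp only [coe_mapBody, Set.mem_ofPred_eq, Set.mem_image, realLin_contractAlong]
    rfl
  have hπ : ∀ z : Fin n → ℤ, intVec (z - z i • β) = intVec z - intVec z i • intVec β := by
    intro z; rw [intVec_sub, intVec_smul]; rfl
  have mapS : ∀ z ∈ S, z - z i • β ∈ T := fun z hz =>
    (memT _).2 ⟨_, (memS z).1 hz, (hπ z).symm⟩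
  have mapS' : ∀ z ∈ S', z - z i • β ∈ T := by
    intro z hz
    obtain ⟨x, hx, y, hy, hxy⟩ := (memS' z).1 hz
    rw [segment_eq_image] at hy
    obtain ⟨c, -, rfl⟩ := hy
    refine (memT _).2 ⟨x, hx, ?_⟩
    rw [hπ, ← hxy]
    simp only [smul_zero, zero_add, Pi.add_apply, Pi.smul_apply, hβ', smul_eq_mul, mul_one]
    module
  rw [Finset.card_eq_sum_card_fiberwise mapS', Finset.card_eq_sum_card_fiberwise mapS,
    Finset.card_eq_sum_ones T, ← Finset.sum_add_distrib]
  refine Finset.sum_congr rfl fun q hq => ?_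
  obtain ⟨x, hx, hxq⟩ := (memT q).1 hq
  have hqi : q i = 0 := by
    have := congrFun hxq i
    simp only [Pi.sub_apply, Pi.smul_apply, hβ', smul_eq_mul, mul_one, sub_self] at this
    exact (Int.cast_eq_zero (α := ℝ)).1 this.symm
  obtain ⟨a, b, hab, h⟩ := exists_preimage_line_eq_Icc P (intVec q) (intVec β) hβ'
    ⟨x i, by rw [← hxq, sub_add_cancel]; exact hx⟩
  have hline : ∀ r : ℤ, intVec (q + r • β) = intVec q + (r : ℝ) • intVec β := by
    intro r; rw [intVec_add, intVec_smul]
  rw [card_filter_line S' i hβ hqi (a := a) (b := b + 1) (fun r => by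
      rw [memS', hline]; exact add_segment_mem_iff hab h r),
    card_filter_line S i hβ hqi (a := a) (b := b) (fun r => by rw [memS, hline]; exact h r)]
  -- The interval `[a, b]` may contain no integer. Nonemptiness still gives this inequality, without
  -- which the truncated cardinalities need not differ by exactly 1.
  have hle : ⌈a⌉ ≤ ⌊b⌋ + 1 := by
    rw [← Int.lt_add_one_iff, ← Int.floor_add_one]
    have h1 := Int.ceil_lt_add_one a
    have h2 := Int.lt_floor_add_one b
    have : (⌈a⌉ : ℝ) < (⌊b⌋ + 1 + 1 : ℤ) := by push_cast; linarith
    rw [Int.floor_add_one]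
    exact_mod_cast this
  rw [Int.card_Icc, Int.card_Icc, Int.floor_add_one]
  omega

theorem classCount_add_seg {n : ℕ} (p : BodyClass n) {i : Fin n} {β : Fin n → ℤ} (hβ : β i = 1) :
    classCount (p + seg β) = classCount p + classCount (mapClass (contractAlong i β) p) := by
  obtain ⟨P, rfl⟩ := bodyClass_surjective p
  exact latticeCount_add_segBody P hβ

theorem mapClass_contractAlong_self {n : ℕ} {i : Fin n} {β : Fin n → ℤ} (hβ : β i = 1) :
    mapClass (contractAlong i β) (seg β) = 0 := by
  rw [mapClass_seg, intLin_contractAlong, hβ, one_smul, sub_self, seg_zero]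

/-- Contracting one copy of the segment collapses all parallel copies to a point, so every copy adds
the same amount. -/
theorem classCount_add_nsmul_seg {n : ℕ} (p : BodyClass n) {i : Fin n} {β : Fin n → ℤ}
    (hβ : β i = 1) (k : ℕ) :
    classCount (p + k • seg β) =
      classCount p + k * classCount (mapClass (contractAlong i β) p) := by
  induction k with
  | zero => simp
  | succ k ih =>
    rw [succ_nsmul, ← add_assoc, classCount_add_seg _ hβ, ih, map_add, map_nsmul,
      mapClass_contractAlong_self hβ, smul_zero, add_zero]
    ring

/-! ## Sums over pairs -/

section PairSum

variable {ι M M' : Type*} [LinearOrder ι] [AddCommMonoid M] [AddCommMonoid M']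

/-- The sum of a function over the pairs `j < i` of a finite set. -/
def pairSum (f : ι → ι → M) (A : Finset ι) : M :=
  ∑ i ∈ A, ∑ j ∈ A with j < i, f i j

theorem pairSum_empty (f : ι → ι → M) : pairSum f ∅ = 0 := rfl

theorem pairSum_congr {f g : ι → ι → M} {A : Finset ι}
    (h : ∀ i ∈ A, ∀ j ∈ A, j < i → f i j = g i j) : pairSum f A = pairSum g A :=
  Finset.sum_congr rfl fun i hi => Finset.sum_congr rfl fun j hj =>
    h i hi j (Finset.mem_filter.1 hj).1 (Finset.mem_filter.1 hj).2

theorem map_pairSum (ψ : M →+ M') (f : ι → ι → M) (A : Finset ι) :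
    ψ (pairSum f A) = pairSum (fun i j => ψ (f i j)) A := by
  simp only [pairSum, map_sum]

theorem pairSum_insert {f : ι → ι → M} (hf : ∀ i j, f i j = f j i) {A : Finset ι} {s : ι}
    (hs : s ∉ A) : pairSum f (insert s A) = pairSum f A + ∑ i ∈ A, f i s := by
  have h1 : ∀ i ∈ A, ∑ j ∈ insert s A with j < i, f i j
      = (∑ j ∈ A with j < i, f i j) + if s < i then f i s else 0 := by
    intro i _
    rw [Finset.filter_insert]
    split_ifs
    · rw [Finset.sum_insert (by simp [hs]), add_comm]
    · rw [add_zero]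
  have h2 : ∑ j ∈ insert s A with j < s, f s j = ∑ i ∈ A, if i < s then f i s else 0 := by
    rw [Finset.filter_insert, if_neg (lt_irrefl s), Finset.sum_filter]
    simp only [hf s]
  rw [pairSum, Finset.sum_insert hs, Finset.sum_congr rfl h1, Finset.sum_add_distrib, h2,
    add_left_comm, ← Finset.sum_add_distrib, pairSum]
  congr 1
  refine Finset.sum_congr rfl fun i hi => ?_
  rcases lt_or_gt_of_ne (ne_of_mem_of_not_mem hi hs) with h | h
  · rw [if_pos h, if_neg h.not_gt, add_zero]
  · rw [if_pos h, if_neg h.not_gt, zero_add]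

theorem pairSum_union {f : ι → ι → M} (hf : ∀ i j, f i j = f j i) {S T : Finset ι}
    (hST : Disjoint S T) :
    pairSum f (S ∪ T) = pairSum f S + pairSum f T + ∑ i ∈ S, ∑ j ∈ T, f i j := by
  induction S using Finset.induction_on with
  | empty => simp [pairSum_empty]
  | insert s S hs ih =>
    rw [Finset.disjoint_insert_left] at hST
    rw [Finset.insert_union, pairSum_insert hf (by simp [hs, hST.1]), ih hST.2,
      pairSum_insert hf hs, Finset.sum_insert hs, Finset.sum_union hST.2]
    simp only [hf s]
    abel

theorem pairSum_const (c : M) (A : Finset ι) :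
    pairSum (fun _ _ => c) A = (A.card.choose 2) • c := by
  induction A using Finset.induction_on with
  | empty => simp [pairSum_empty]
  | insert s S hs ih =>
    rw [pairSum_insert (fun _ _ => rfl) hs, ih, Finset.card_insert_of_notMem hs,
      Finset.sum_const, ← add_smul, Nat.choose_succ_succ' S.card 1, Nat.choose_one_right, add_comm]

/-- Bookkeeping for merging the vertices of `S`: `c` is what an edge inside `S` becomes, `d j` what
an edge from `S` to an outside vertex `j` becomes, and edges outside `S` are untouched. -/
theorem map_pairSum_collapse {f : ι → ι → M} (hf : ∀ i j, f i j = f j i) {A S : Finset ι}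
    (hS : S ⊆ A) (ψ : M →+ M) (c : M) (d : ι → M)
    (hc : ∀ i ∈ S, ∀ j ∈ S, i ≠ j → ψ (f i j) = c)
    (hd : ∀ i ∈ S, ∀ j ∈ A \ S, ψ (f i j) = d j)
    (hfix : ∀ i ∈ A \ S, ∀ j ∈ A \ S, ψ (f i j) = f i j) :
    ψ (pairSum f A) =
      pairSum f (A \ S) + S.card • ∑ j ∈ A \ S, d j + (S.card.choose 2) • c := by
  rw [← Finset.union_sdiff_of_subset hS, pairSum_union hf Finset.disjoint_sdiff, map_add, map_add,
    Finset.union_sdiff_of_subset hS, map_pairSum, map_pairSum,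
    pairSum_congr (fun i hi j hj hij => hc i hi j hj hij.ne'), pairSum_const,
    pairSum_congr (fun i hi j hj _ => hfix i hi j hj), map_sum,
    Finset.sum_congr rfl fun i hi => by
      rw [map_sum, Finset.sum_congr rfl fun j hj => hd i hi j hj], Finset.sum_const]
  abel

theorem map_sum_collapse {f : ι → M} {A S : Finset ι} (hS : S ⊆ A) (ψ : M →+ M) (c : M)
    (hc : ∀ i ∈ S, ψ (f i) = c) (hfix : ∀ i ∈ A \ S, ψ (f i) = f i) :
    ψ (∑ i ∈ A, f i) = ∑ i ∈ A \ S, f i + S.card • c := by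
  rw [← Finset.sum_sdiff hS, map_add, map_sum, map_sum, Finset.sum_congr rfl hc,
    Finset.sum_congr rfl hfix, Finset.sum_const]

end PairSum

/-! ## Contracting the edges at a vertex -/

/-- The standard basis vector. -/
def basisVec {n : ℕ} (i : Fin n) : Fin n → ℤ := Pi.single i 1

/-- The map sending `e_i` to `σ e_s` for `i ∈ S` and fixing the other basis vectors. -/
def mergeMap {n : ℕ} (σ : ℤ) (S : Finset (Fin n)) (s : Fin n) (j : Fin n) : Fin n → ℤ :=
  if j ∈ S then σ • basisVec s else basisVec j

theorem intLin_basisVec {n : ℕ} (g : Fin n → Fin n → ℤ) (j : Fin n) :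
    intLin g (basisVec j) = g j := intLin_single g j

theorem mergeMap_of_mem {n : ℕ} {σ : ℤ} {S : Finset (Fin n)} {s j : Fin n} (h : j ∈ S) :
    mergeMap σ S s j = σ • basisVec s := if_pos h

theorem mergeMap_of_notMem {n : ℕ} {σ : ℤ} {S : Finset (Fin n)} {s j : Fin n} (h : j ∉ S) :
    mergeMap σ S s j = basisVec j := if_neg h

theorem mapClass_mergeMap_empty {n : ℕ} (σ : ℤ) (s : Fin n) (p : BodyClass n) :
    mapClass (mergeMap σ ∅ s) p = p := by
  obtain ⟨P, rfl⟩ := bodyClass_surjective p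
  rw [mapClass_bodyClass]
  congr 1
  apply ConvexBody.ext
  have : realLin (mergeMap σ ∅ s) = LinearMap.id := by
    refine LinearMap.pi_ext' fun j => LinearMap.ext_ring ?_
    simp only [LinearMap.comp_apply, LinearMap.single_apply, LinearMap.id_apply]
    simp only [realLin, Fintype.linearCombination_apply_single, one_smul]
    rw [mergeMap_of_notMem (Finset.notMem_empty _)]
    ext k
    simp [intVec, basisVec, Pi.single_apply]
  rw [coe_mapBody, this]
  exact Set.image_id _

theorem mapClass_mergeMap_insert {n : ℕ} (σ : ℤ) {S : Finset (Fin n)} {s i : Fin n} (hs : s ∉ S)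
    (p : BodyClass n) :
    mapClass (mergeMap σ S s) (mapClass (mergeMap σ {i} s) p) =
      mapClass (mergeMap σ (insert i S) s) p := by
  rw [mapClass_mapClass]
  congr 2
  funext j
  by_cases hj : j = i
  · rw [mergeMap_of_mem (Finset.mem_singleton.2 hj),
      mergeMap_of_mem (hj ▸ Finset.mem_insert_self _ _), map_smul, intLin_basisVec,
      mergeMap_of_notMem hs]
  · rw [mergeMap_of_notMem (by simpa using hj), intLin_basisVec]
    simp only [mergeMap, Finset.mem_insert, hj, false_or]

/-- Projecting along `e_i - σ e_s` identifies `e_i` with `σ e_s`: contraction of an edge merges its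
ends. -/
theorem contractAlong_eq_mergeMap {n : ℕ} (σ : ℤ) (s i : Fin n) :
    contractAlong i (basisVec i - σ • basisVec s) = mergeMap σ {i} s := by
  funext j
  by_cases hj : j = i
  · subst hj
    rw [mergeMap_of_mem (Finset.mem_singleton_self _), contractAlong, if_pos rfl]
    simp [basisVec]
  · rw [mergeMap_of_notMem (by simpa using hj), contractAlong, if_neg hj, sub_zero, basisVec]

/-- Deletion and contraction are applied to the edges at `s` in turn. Contracting the one to `i`
leaves the other star edges unchanged, so the choices are independent: `S` is the set of contracted
edges, each with `c` choices of a copy. -/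
theorem classCount_add_sum_star {n : ℕ} (σ : ℤ) (c : ℕ) {s : Fin n} {A : Finset (Fin n)}
    (hs : s ∉ A) (p : BodyClass n) :
    classCount (p + c • ∑ i ∈ A, seg (basisVec i - σ • basisVec s)) =
      ∑ S ∈ A.powerset, c ^ S.card * classCount (mapClass (mergeMap σ S s) p) := by
  induction A using Finset.induction_on generalizing p with
  | empty => simp [mapClass_mergeMap_empty]
  | insert i A hi ih =>
    rw [Finset.mem_insert, not_or] at hs
    have hone : (basisVec i - σ • basisVec s : Fin n → ℤ) i = 1 := by
      simp [basisVec, Ne.symm hs.1]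
    rw [Finset.sum_insert hi, smul_add, add_comm (c • _), ← add_assoc,
      classCount_add_nsmul_seg _ hone, ih hs.2, contractAlong_eq_mergeMap, map_add, map_nsmul,
      map_sum, Finset.sum_powerset_insert hi]
    congr 1
    have : ∀ j ∈ A, mapClass (mergeMap σ {i} s) (seg (basisVec j - σ • basisVec s))
        = seg (basisVec j - σ • basisVec s) := by
      intro j hj
      rw [mapClass_seg, map_sub, map_smul, intLin_basisVec, intLin_basisVec,
        mergeMap_of_notMem (by rw [Finset.mem_singleton]; exact ne_of_mem_of_not_mem hj hi),
        mergeMap_of_notMem (by rw [Finset.mem_singleton]; exact hs.1)]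
    rw [Finset.sum_congr rfl this, ih hs.2, Finset.mul_sum]
    refine Finset.sum_congr rfl fun S hS => ?_
    rw [Finset.mem_powerset] at hS
    rw [mapClass_mergeMap_insert σ (fun h => hs.2 (hS h)),
      Finset.card_insert_of_notMem (fun h => hi (hS h))]
    ring

/-! ## Recursion in type `A` -/

/-- The class of the segment of the root `e_i - e_j`. -/
noncomputable def negEdge {n : ℕ} (i j : Fin n) : BodyClass n := seg (basisVec i - basisVec j)

theorem negEdge_comm {n : ℕ} (i j : Fin n) : negEdge i j = negEdge j i := by
  rw [negEdge, ← seg_neg, neg_sub, negEdge]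

theorem mapClass_negEdge {n : ℕ} (g : Fin n → Fin n → ℤ) (i j : Fin n) :
    mapClass g (negEdge i j) = seg (g i - g j) := by
  rw [negEdge, mapClass_seg, map_sub, intLin_basisVec, intLin_basisVec]

/-- Edges inside `S` become loops, which are points; each outside vertex keeps one edge to `s` for
every element of `S`. -/
theorem mapClass_pairSum_negEdge {n : ℕ} {A S : Finset (Fin n)} {s : Fin n} (hS : S ⊆ A) :
    mapClass (mergeMap 1 S s) (pairSum negEdge A) =
      pairSum negEdge (A \ S) + S.card • ∑ j ∈ A \ S, negEdge j s := by
  rw [map_pairSum_collapse negEdge_comm hS _ 0 (fun j => negEdge j s), smul_zero, add_zero]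
  · intro i hi j hj _
    rw [mapClass_negEdge, mergeMap_of_mem hi, mergeMap_of_mem hj, sub_self, seg_zero]
  · intro i hi j hj
    rw [mapClass_negEdge, mergeMap_of_mem hi, mergeMap_of_notMem (Finset.mem_sdiff.1 hj).2,
      one_smul]
    exact negEdge_comm s j
  · intro i hi j hj
    rw [mapClass_negEdge, mergeMap_of_notMem (Finset.mem_sdiff.1 hi).2,
      mergeMap_of_notMem (Finset.mem_sdiff.1 hj).2]
    rfl

theorem sum_powerset_of_card {ι R : Type*} [DecidableEq ι] [CommSemiring R] {A : Finset ι}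
    (g : Finset ι → R) (f : ℕ → R) (h : ∀ S ⊆ A, g S = f S.card) :
    ∑ S ∈ A.powerset, g S = ∑ k ∈ Finset.range (A.card + 1), (A.card.choose k : R) * f k := by
  rw [Finset.sum_congr rfl fun S hS => h S (Finset.mem_powerset.1 hS),
    Finset.sum_powerset_apply_card]
  simp only [nsmul_eq_mul]

/-- The recursion for lattice points of complete graphs with an additional vertex of
multiplicity `a`. -/
structure IsTypeARecursion (t : ℚ) (F : ℕ → ℕ → ℚ) : Prop where
  zero : F 0 0 = 1
  succ : ∀ m, F (m + 1) 0 = F m 1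
  star : ∀ m a, F m a =
    ∑ k ∈ Finset.range (m + 1), (m.choose k : ℚ) * ((a * t) ^ k * F (m - k) k)

/-- Setting one vertex `s` of `A` apart turns the complete graph into a smaller one with a star of
multiplicity 1. The star expansion then leads to smaller sets again, with multiplicity `S.card` at
`s`. -/
theorem IsTypeARecursion.classCount_eq {t : ℕ} {F : ℕ → ℕ → ℚ} (hF : IsTypeARecursion t F)
    {n : ℕ} (m : ℕ) (A : Finset (Fin n)) (hA : A.card = m) :
    (classCount (t • pairSum negEdge A) : ℚ) = F m 0 ∧
    ∀ s ∉ A, ∀ a : ℕ, (classCount (t • pairSum negEdge A + (a * t) • ∑ i ∈ A, negEdge i s) : ℚ)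
      = F m a := by
  induction m using Nat.strong_induction_on generalizing A with
  | _ m ih =>
  have h0 : (classCount (t • pairSum negEdge A) : ℚ) = F m 0 := by
    rcases A.eq_empty_or_nonempty with rfl | ⟨s, hs⟩
    · rw [← hA]
      simp [pairSum_empty, classCount_zero, hF.zero]
    · have hc := Finset.card_erase_add_one hs
      rw [hA] at hc
      rw [← Finset.insert_erase hs, pairSum_insert negEdge_comm (Finset.notMem_erase s A),
        smul_add, ← hc, hF.succ, ← (ih _ (by omega) (A.erase s) rfl).2 s (Finset.notMem_erase s A)]
      simp
  refine ⟨h0, fun s hs a => ?_⟩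
  have hstar := classCount_add_sum_star 1 (a * t) hs (t • pairSum negEdge A)
  simp only [one_smul] at hstar
  simp only [← negEdge.eq_def] at hstar
  rw [hstar, hF.star]
  push_cast
  rw [← hA]
  refine sum_powerset_of_card _ (fun k => (a * t : ℚ) ^ k * F (A.card - k) k) fun S hS => ?_
  congr 1
  -- The empty `S` does not shrink `A`, so its term cannot come from the induction hypothesis; it
  -- comes from `h0`.
  rcases S.eq_empty_or_nonempty with rfl | hne
  · rw [mapClass_mergeMap_empty, h0, hA]; simp
  · have hpos := hne.card_pos
    have hle := Finset.card_le_card hS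
    have hcard := Finset.card_sdiff_of_subset hS
    rw [map_nsmul, mapClass_pairSum_negEdge hS, smul_add, smul_smul, mul_comm t,
      (ih _ (by omega) (A \ S) hcard).2 s (fun h => hs (Finset.mem_sdiff.1 h).1), hA]

/-! ## Recursion in types `B`, `C`, `D` -/

/-- The class of the sum of the segments of the roots `e_i - e_j` and `e_i + e_j`. -/
noncomputable def signedEdge {n : ℕ} (i j : Fin n) : BodyClass n :=
  seg (basisVec i - basisVec j) + seg (basisVec i + basisVec j)

/-- The class of the segment of the root `e_i`. -/
noncomputable def halfEdge {n : ℕ} (i : Fin n) : BodyClass n := seg (basisVec i)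

theorem signedEdge_comm {n : ℕ} (i j : Fin n) : signedEdge i j = signedEdge j i := by
  rw [signedEdge, ← seg_neg, neg_sub, add_comm (basisVec i), signedEdge]

theorem seg_unit_smul {n : ℕ} {σ : ℤ} (hσ : σ = 1 ∨ σ = -1) (v : Fin n → ℤ) :
    seg (σ • v) = seg v := by
  rcases hσ with rfl | rfl <;> simp [seg_neg]

theorem mapClass_signedEdge {n : ℕ} (g : Fin n → Fin n → ℤ) (i j : Fin n) :
    mapClass g (signedEdge i j) = seg (g i - g j) + seg (g i + g j) := by
  rw [signedEdge, map_add, mapClass_seg, mapClass_seg, map_sub, map_add, intLin_basisVec,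
    intLin_basisVec]

theorem mapClass_halfEdge {n : ℕ} (g : Fin n → Fin n → ℤ) (i : Fin n) :
    mapClass g (halfEdge i) = seg (g i) := by
  rw [halfEdge, mapClass_seg, intLin_basisVec]

section Merge

variable {n : ℕ} {σ : ℤ} {A S : Finset (Fin n)} {s : Fin n}

theorem mapClass_mergeMap_halfEdge_of_mem (hσ : σ = 1 ∨ σ = -1) {i : Fin n} (hi : i ∈ S) :
    mapClass (mergeMap σ S s) (halfEdge i) = halfEdge s := by
  rw [mapClass_halfEdge, mergeMap_of_mem hi, seg_unit_smul hσ, halfEdge]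

theorem mapClass_mergeMap_halfEdge_of_notMem {i : Fin n} (hi : i ∉ S) :
    mapClass (mergeMap σ S s) (halfEdge i) = halfEdge i := by
  rw [mapClass_halfEdge, mergeMap_of_notMem hi, halfEdge]

theorem mapClass_mergeMap_signedEdge_of_mem (hσ : σ = 1 ∨ σ = -1) {i j : Fin n} (hi : i ∈ S)
    (hj : j ∈ S) : mapClass (mergeMap σ S s) (signedEdge i j) = 2 • halfEdge s := by
  rw [mapClass_signedEdge, mergeMap_of_mem hi, mergeMap_of_mem hj, sub_self, seg_zero, zero_add,
    ← two_smul ℤ, seg_two_smul, seg_unit_smul hσ, halfEdge]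

/-- A sign `σ = -1` only exchanges the segments of the two edges, up to translation. -/
theorem mapClass_mergeMap_signedEdge_of_mem_of_notMem (hσ : σ = 1 ∨ σ = -1) {i j : Fin n}
    (hi : i ∈ S) (hj : j ∉ S) :
    mapClass (mergeMap σ S s) (signedEdge i j) = signedEdge j s := by
  rw [mapClass_signedEdge, mergeMap_of_mem hi, mergeMap_of_notMem hj, signedEdge_comm, signedEdge]
  rcases hσ with rfl | rfl
  · simp only [one_smul]
  · rw [neg_one_smul, add_comm, ← sub_eq_neg_add, ← neg_add', seg_neg, ← seg_neg, neg_sub]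

theorem mapClass_mergeMap_signedEdge_self (hσ : σ = 1 ∨ σ = -1) (hs : s ∉ S) {i : Fin n}
    (hi : i ∈ S) : mapClass (mergeMap σ S s) (signedEdge i s) = 2 • halfEdge s := by
  rw [mapClass_mergeMap_signedEdge_of_mem_of_notMem hσ hi hs, signedEdge, sub_self, seg_zero,
    zero_add, ← two_smul ℤ, seg_two_smul, halfEdge]

theorem mapClass_mergeMap_signedEdge_of_notMem {i j : Fin n} (hi : i ∉ S) (hj : j ∉ S) :
    mapClass (mergeMap σ S s) (signedEdge i j) = signedEdge i j := by
  rw [mapClass_signedEdge, mergeMap_of_notMem hi, mergeMap_of_notMem hj, signedEdge]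

/-- The class of the Minkowski sum of `t` copies of the roots of type `D` and `h` copies of the
basis vectors indexed by `A`. -/
noncomputable def typeBClass (t h : ℕ) (A : Finset (Fin n)) : BodyClass n :=
  t • pairSum signedEdge A + h • ∑ i ∈ A, halfEdge i

/-- Of the two edges joining a pair inside `S`, one becomes a point and the other `± 2 e_s`. This
gives `2 t` half edges at `s` per pair, besides the `h` brought along by each merged vertex. -/
theorem mapClass_mergeMap_typeBClass (hσ : σ = 1 ∨ σ = -1) (t h : ℕ) (hS : S ⊆ A) :
    mapClass (mergeMap σ S s) (typeBClass t h A) =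
      typeBClass t h (A \ S) + (S.card * t) • ∑ i ∈ A \ S, signedEdge i s +
        (2 * t * S.card.choose 2 + h * S.card) • halfEdge s := by
  rw [typeBClass, map_add, map_nsmul, map_nsmul,
    map_pairSum_collapse signedEdge_comm hS _ (2 • halfEdge s) (fun j => signedEdge j s)
      (fun i hi j hj _ => mapClass_mergeMap_signedEdge_of_mem hσ hi hj)
      (fun i hi j hj =>
        mapClass_mergeMap_signedEdge_of_mem_of_notMem hσ hi (Finset.mem_sdiff.1 hj).2)
      (fun i hi j hj => mapClass_mergeMap_signedEdge_of_notMem (Finset.mem_sdiff.1 hi).2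
        (Finset.mem_sdiff.1 hj).2),
    map_sum_collapse hS _ (halfEdge s) (fun i hi => mapClass_mergeMap_halfEdge_of_mem hσ hi)
      (fun i hi => mapClass_mergeMap_halfEdge_of_notMem (Finset.mem_sdiff.1 hi).2), typeBClass]
  simp only [smul_add, smul_smul, add_smul]
  rw [mul_comm t S.card, show t * (S.card.choose 2 * 2) = 2 * t * S.card.choose 2 by ring]
  abel

theorem mapClass_mergeMap_sum_signedEdge (hσ : σ = 1 ∨ σ = -1) (hS : S ⊆ A) (hs : s ∉ A) :
    mapClass (mergeMap σ S s) (∑ i ∈ A, signedEdge i s) =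
      ∑ i ∈ A \ S, signedEdge i s + (2 * S.card) • halfEdge s := by
  rw [map_sum_collapse hS _ (2 • halfEdge s)
    (fun i hi => mapClass_mergeMap_signedEdge_self hσ (fun h => hs (hS h)) hi)
    (fun i hi => mapClass_mergeMap_signedEdge_of_notMem (Finset.mem_sdiff.1 hi).2
      (fun h => hs (hS h))), smul_smul, mul_comm 2]

theorem mapClass_mergeMap_sum_posEdge (hS : S ⊆ A) (hs : s ∉ A) :
    mapClass (mergeMap 1 S s) (∑ i ∈ A, seg (basisVec i + basisVec s)) =
      ∑ i ∈ A \ S, seg (basisVec i + basisVec s) + (2 * S.card) • halfEdge s := by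
  rw [map_sum_collapse hS _ (2 • halfEdge s), smul_smul, mul_comm 2]
  · intro i hi
    rw [mapClass_seg, map_add, intLin_basisVec, intLin_basisVec, mergeMap_of_mem hi,
      mergeMap_of_notMem (fun h => hs (hS h)), one_smul, ← two_smul ℤ, seg_two_smul, halfEdge]
  · intro i hi
    rw [mapClass_seg, map_add, intLin_basisVec, intLin_basisVec,
      mergeMap_of_notMem (Finset.mem_sdiff.1 hi).2, mergeMap_of_notMem (fun h => hs (hS h))]

end Merge

/-- The class `typeBClass` with an additional vertex `s` joined to each vertex of `A` by `c` signed
edges. -/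
noncomputable def typeBStarClass {n : ℕ} (t h : ℕ) (A : Finset (Fin n)) (s : Fin n) (c : ℕ) :
    BodyClass n :=
  typeBClass t h A + c • ∑ i ∈ A, signedEdge i s

/-- Contracting a half edge sends `e_s` to 0, so both edges of a signed edge from `i` to `s` become
the half edge at `i`; hence the shift of `h` by `2 * c`. -/
theorem classCount_typeBStarClass_add_halfEdge {n : ℕ} (t h c b : ℕ) {A : Finset (Fin n)}
    {s : Fin n} (hs : s ∉ A) :
    classCount (typeBStarClass t h A s c + b • halfEdge s) =
      classCount (typeBStarClass t h A s c) + b * classCount (typeBClass t (h + 2 * c) A) := by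
  have hone : (basisVec s : Fin n → ℤ) s = 1 := by simp [basisVec]
  rw [halfEdge, classCount_add_nsmul_seg _ hone]
  have hg : ∀ i ∈ A, contractAlong s (basisVec s) i = basisVec i := by
    intro i hi
    rw [contractAlong, if_neg (ne_of_mem_of_not_mem hi hs), sub_zero, basisVec]
  have hgs : contractAlong s (basisVec s) s = 0 := by
    rw [contractAlong, if_pos rfl, basisVec, sub_self]
  have h1 : ∀ i ∈ A, mapClass (contractAlong s (basisVec s)) (signedEdge i s)
      = 2 • halfEdge i := by
    intro i hi
    rw [mapClass_signedEdge, hg i hi, hgs, sub_zero, add_zero, two_nsmul, halfEdge]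
  have h2 : ∀ i ∈ A, mapClass (contractAlong s (basisVec s)) (halfEdge i) = halfEdge i := by
    intro i hi
    rw [mapClass_halfEdge, hg i hi, halfEdge]
  have h3 : ∀ i ∈ A, ∀ j ∈ A, mapClass (contractAlong s (basisVec s)) (signedEdge i j)
      = signedEdge i j := by
    intro i hi j hj
    rw [mapClass_signedEdge, hg i hi, hg j hj, signedEdge]
  congr 3
  rw [typeBStarClass, typeBClass, typeBClass, map_add, map_add, map_nsmul, map_nsmul, map_nsmul,
    map_pairSum, pairSum_congr (fun i hi j hj _ => h3 i hi j hj), map_sum, map_sum,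
    Finset.sum_congr rfl h1, Finset.sum_congr rfl h2, ← Finset.smul_sum, smul_smul, add_smul,
    mul_comm c, add_assoc]

/-- The negative edges at `s` are expanded first, with contracted set `S`, then the positive edges
to `A \ S`, with contracted set `L`. The asymmetric term `2 * c * S.card` comes from the positive
edges parallel to the contracted negative ones, which turn into `2 e_s`; over `L` the negative edges
have already been deleted. -/
theorem classCount_typeBStarClass {n : ℕ} (t h c : ℕ) {A : Finset (Fin n)} {s : Fin n}
    (hs : s ∉ A) :
    classCount (typeBStarClass t h A s c) =
      ∑ S ∈ A.powerset, c ^ S.card * ∑ L ∈ (A \ S).powerset, c ^ L.card *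
        classCount (typeBStarClass t h ((A \ S) \ L) s ((S.card + L.card) * t) +
          (2 * t * (S.card + L.card).choose 2 + h * (S.card + L.card) + 2 * c * S.card) •
            halfEdge s) := by
  have hsplit : typeBStarClass t h A s c =
      (typeBClass t h A + c • ∑ i ∈ A, seg (basisVec i + basisVec s)) +
        c • ∑ i ∈ A, seg (basisVec i - (1 : ℤ) • basisVec s) := by
    simp only [typeBStarClass, signedEdge, one_smul, Finset.sum_add_distrib, smul_add]
    abel
  rw [hsplit, classCount_add_sum_star 1 c hs]
  refine Finset.sum_congr rfl fun S hS => ?_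
  rw [Finset.mem_powerset] at hS
  congr 1
  have hs' : s ∉ A \ S := fun h => hs (Finset.mem_sdiff.1 h).1
  have hsplit' : mapClass (mergeMap 1 S s)
      (typeBClass t h A + c • ∑ i ∈ A, seg (basisVec i + basisVec s)) =
      (typeBClass t h (A \ S) + (S.card * t) • ∑ i ∈ A \ S, signedEdge i s +
        (2 * t * S.card.choose 2 + h * S.card + c * (2 * S.card)) • halfEdge s) +
        c • ∑ i ∈ A \ S, seg (basisVec i - (-1 : ℤ) • basisVec s) := by
    rw [map_add, map_nsmul, mapClass_mergeMap_typeBClass (Or.inl rfl) t h hS,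
      mapClass_mergeMap_sum_posEdge hS hs]
    simp only [neg_smul, one_smul, sub_neg_eq_add, smul_add, add_smul, smul_smul]
    abel
  rw [hsplit', classCount_add_sum_star (-1) c hs']
  refine Finset.sum_congr rfl fun L hL => ?_
  rw [Finset.mem_powerset] at hL
  congr 2
  rw [map_add, map_add, map_nsmul, map_nsmul, mapClass_mergeMap_typeBClass (Or.inr rfl) t h hL,
    mapClass_mergeMap_sum_signedEdge (Or.inr rfl) hL hs',
    mapClass_mergeMap_halfEdge_of_notMem (fun h => hs' (hL h)), typeBStarClass]
  -- The cross term accounts for the edges between `S` and `L`, which after the first merging are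
  -- star edges of multiplicity `S.card * t` at `s`.
  have hch : (S.card + L.card).choose 2 =
      S.card.choose 2 + L.card.choose 2 + S.card * L.card := by
    have := Nat.add_choose_eq S.card L.card 2
    rw [this, Finset.Nat.sum_antidiagonal_eq_sum_range_succ_mk]
    simp [Finset.sum_range_succ]
    ring
  rw [hch]
  have hb : 2 * t * (S.card.choose 2 + L.card.choose 2 + S.card * L.card) +
      h * (S.card + L.card) + 2 * c * S.card =
      (2 * t * L.card.choose 2 + h * L.card) + (S.card * t) * (2 * L.card) +
        (2 * t * S.card.choose 2 + h * S.card + c * (2 * S.card)) := by ring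
  rw [hb, smul_add, smul_smul, add_mul, add_smul (S.card * t), add_smul (_ + _) (_ + _),
    add_smul (2 * t * L.card.choose 2 + h * L.card)]
  abel

/-- The recursion for lattice points of signed complete graphs with `h` half edges at each vertex,
without and with an additional vertex of multiplicity `a`. -/
structure IsTypeBRecursion (t : ℚ) (M : ℕ → ℚ → ℚ) (N : ℕ → ℕ → ℚ → ℚ) : Prop where
  zero : ∀ h, M 0 h = 1
  succ : ∀ m h, M (m + 1) h = N m 1 h + h * M m (h + 2 * t)
  isolated : ∀ m h, N m 0 h = M m h
  star : ∀ m a h, N m a h =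
    ∑ k ∈ Finset.range (m + 1), (m.choose k : ℚ) * ((a * t) ^ k *
      ∑ l ∈ Finset.range (m - k + 1), ((m - k).choose l : ℚ) * ((a * t) ^ l *
        (N (m - k - l) (k + l) h +
          (t * ((k + l) * (k + l - 1)) + h * (k + l) + 2 * (a * t) * k) *
            M (m - k - l) (h + 2 * ((k + l) * t)))))

/-- The induction has the shape of type A, with `h` varying. The term with `k + l = 0` does not
shrink `A` and is handled by `h0` and the field `isolated`. -/
theorem IsTypeBRecursion.classCount_eq {t : ℕ} {M : ℕ → ℚ → ℚ} {N : ℕ → ℕ → ℚ → ℚ}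
    (hF : IsTypeBRecursion t M N) {n : ℕ} (m : ℕ) (A : Finset (Fin n)) (hA : A.card = m) :
    (∀ h : ℕ, (classCount (typeBClass t h A) : ℚ) = M m h) ∧
    ∀ s ∉ A, ∀ a h : ℕ, (classCount (typeBStarClass t h A s (a * t)) : ℚ) = N m a h := by
  induction m using Nat.strong_induction_on generalizing A with
  | _ m ih =>
  have h0 : ∀ h : ℕ, (classCount (typeBClass t h A) : ℚ) = M m h := by
    intro h
    rcases A.eq_empty_or_nonempty with rfl | ⟨s, hs⟩
    · rw [← hA]
      simp [typeBClass, pairSum_empty, classCount_zero, hF.zero]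
    · have hc := Finset.card_erase_add_one hs
      rw [hA] at hc
      have hs' := Finset.notMem_erase s A
      have hsplit : typeBClass t h A = typeBStarClass t h (A.erase s) s (1 * t) + h • halfEdge s := by
        conv_lhs => rw [← Finset.insert_erase hs]
        rw [typeBClass, pairSum_insert signedEdge_comm hs', Finset.sum_insert hs', typeBStarClass,
          typeBClass, one_mul, smul_add, smul_add]
        abel
      rw [hsplit, classCount_typeBStarClass_add_halfEdge _ _ _ _ hs', ← hc, hF.succ]
      have hlt : (A.erase s).card < m := by omega
      have h1 := (ih _ hlt (A.erase s) rfl).2 s hs' 1 h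
      have h2 := (ih _ hlt (A.erase s) rfl).1 (h + 2 * (1 * t))
      push_cast at h1 h2 ⊢
      rw [h1, h2, one_mul]
  refine ⟨h0, fun s hs a h => ?_⟩
  rw [classCount_typeBStarClass t h (a * t) hs, hF.star]
  push_cast
  subst hA
  refine sum_powerset_of_card _ (fun k => (a * t : ℚ) ^ k *
      ∑ l ∈ Finset.range (A.card - k + 1), ((A.card - k).choose l : ℚ) * ((a * t) ^ l *
        (N (A.card - k - l) (k + l) h +
          (t * ((k + l) * (k + l - 1)) + h * (k + l) + 2 * (a * t) * k) *
            M (A.card - k - l) (h + 2 * ((k + l) * t))))) fun S hS => ?_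
  congr 1
  have hcardS := Finset.card_sdiff_of_subset hS
  rw [← hcardS]
  refine sum_powerset_of_card _ (fun l => (a * t : ℚ) ^ l *
        (N ((A \ S).card - l) (S.card + l) h +
          (t * ((S.card + l) * (S.card + l - 1)) + h * (S.card + l) + 2 * (a * t) * S.card) *
            M ((A \ S).card - l) (h + 2 * ((S.card + l) * t)))) fun L hL => ?_
  congr 1
  have hcardL := Finset.card_sdiff_of_subset hL
  have hleS := Finset.card_le_card hS
  have hleL := Finset.card_le_card hL
  have hs' : s ∉ (A \ S) \ L := fun h => hs (Finset.mem_sdiff.1 (Finset.mem_sdiff.1 h).1).1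
  rw [classCount_typeBStarClass_add_halfEdge _ _ _ _ hs', ← hcardL]
  have hstar : (classCount (typeBStarClass t h ((A \ S) \ L) s ((S.card + L.card) * t)) : ℚ) =
      N ((A \ S) \ L).card (S.card + L.card) h := by
    rcases Nat.eq_zero_or_pos (S.card + L.card) with hz | hpos
    · obtain ⟨hSz, hLz⟩ := Nat.add_eq_zero_iff.1 hz
      rw [Finset.card_eq_zero] at hSz hLz
      subst hSz hLz
      simp [typeBStarClass, hF.isolated, h0]
    · exact (ih _ (by omega) _ rfl).2 s hs' _ h
  have hbase : (classCount (typeBClass t (h + 2 * ((S.card + L.card) * t)) ((A \ S) \ L)) : ℚ) =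
      M ((A \ S) \ L).card (h + 2 * ((S.card + L.card) * t)) := by
    rcases Nat.eq_zero_or_pos (S.card + L.card) with hz | hpos
    · obtain ⟨hSz, hLz⟩ := Nat.add_eq_zero_iff.1 hz
      rw [Finset.card_eq_zero] at hSz hLz
      subst hSz hLz
      simp [h0]
    · have := (ih _ (by omega) ((A \ S) \ L) rfl).1 (h + 2 * ((S.card + L.card) * t))
      push_cast at this
      exact this
  push_cast
  rw [hstar, hbase, Nat.cast_choose_two]
  push_cast
  ring

/-! ## Coxeter permutahedra -/

theorem coe_sum_segBody {n : ℕ} (Φ : Finset (Fin n → ℤ)) :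
    ((∑ α ∈ Φ, segBody α : ConvexBody (Fin n → ℝ)) : Set (Fin n → ℝ)) =
      integralCoxeterPermutahedron Φ := by
  classical
  unfold integralCoxeterPermutahedron
  induction Φ using Finset.induction_on with
  | empty => simp
  | insert a s ha ih => rw [Finset.sum_insert ha, Finset.sum_insert ha, ConvexBody.coe_add, ih]; rfl

/-- For a convex body the `t`-fold Minkowski sum is the dilate by `t`, so dilation multiplies edge
multiplicities by `t`. -/
theorem coe_nsmul_body {n : ℕ} (t : ℕ) (P : ConvexBody (Fin n → ℝ)) :
    ((t • P : ConvexBody (Fin n → ℝ)) : Set (Fin n → ℝ)) = (t : ℝ) • (P : Set (Fin n → ℝ)) := by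
  rw [← Nat.cast_smul_eq_nsmul NNReal t P, ConvexBody.coe_smul']
  ext x
  simp [Set.mem_smul_set, NNReal.smul_def]

theorem dilateLatticePoints_finite_and_ncard {n : ℕ} (Φ : Finset (Fin n → ℤ)) (t : ℕ) :
    (dilateLatticePoints (integralCoxeterPermutahedron Φ) t).Finite ∧
      (dilateLatticePoints (integralCoxeterPermutahedron Φ) t).ncard =
        classCount (t • ∑ α ∈ Φ, seg α) := by
  have h : ((t • ∑ α ∈ Φ, segBody α : ConvexBody (Fin n → ℝ)) : Set (Fin n → ℝ)) =
      (t : ℝ) • integralCoxeterPermutahedron Φ := by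
    rw [coe_nsmul_body, coe_sum_segBody]
  constructor
  · rw [dilateLatticePoints, ← h]
    exact finite_latticePoints (ConvexBody.isBounded _)
  · rw [dilateLatticePoints, ← h]
    simp only [seg]
    rw [← map_sum, ← map_nsmul]
    rfl

theorem sum_filter_lt_eq_pairSum {n : ℕ} {M : Type*} [AddCommMonoid M] {f : Fin n → Fin n → M}
    (hf : ∀ i j, f i j = f j i) :
    ∑ p : Fin n × Fin n with p.1 < p.2, f p.1 p.2 = pairSum f Finset.univ := by
  simp only [pairSum, Finset.sum_filter]
  rw [Fintype.sum_prod_type, Finset.sum_comm]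
  simp only [hf]

theorem injOn_sub_single (n : ℕ) :
    Set.InjOn (fun p : Fin n × Fin n => (Pi.single p.1 1 - Pi.single p.2 1 : Fin n → ℤ))
      {p | p.1 < p.2} := by
  rintro ⟨i, j⟩ hij ⟨k, l⟩ hkl h
  simp only [Set.mem_ofPred_eq] at hij hkl h
  have h1 := congrFun h i
  have h2 := congrFun h j
  simp only [Pi.sub_apply, Pi.single_apply] at h1 h2
  grind

theorem injOn_add_single (n : ℕ) :
    Set.InjOn (fun p : Fin n × Fin n => (Pi.single p.1 1 + Pi.single p.2 1 : Fin n → ℤ))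
      {p | p.1 < p.2} := by
  rintro ⟨i, j⟩ hij ⟨k, l⟩ hkl h
  simp only [Set.mem_ofPred_eq] at hij hkl h
  have h1 := congrFun h i
  have h2 := congrFun h j
  simp only [Pi.add_apply, Pi.single_apply] at h1 h2
  grind

theorem sum_positiveRootsA (n : ℕ) :
    ∑ α ∈ positiveRootsA n, seg α = pairSum negEdge Finset.univ := by
  rw [positiveRootsA, Finset.sum_image (by simpa using injOn_sub_single n),
    ← sum_filter_lt_eq_pairSum negEdge_comm]
  rfl

theorem sum_positiveRootsD (n : ℕ) :
    ∑ α ∈ positiveRootsD n, seg α = pairSum signedEdge Finset.univ := by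
  have hdisj : Disjoint (positiveRootsA n)
      (((Finset.univ : Finset (Fin n × Fin n)).filter fun p => p.1 < p.2).image
        fun p => Pi.single p.1 1 + Pi.single p.2 1) := by
    rw [Finset.disjoint_left]
    intro x hx hx'
    simp only [positiveRootsA, Finset.mem_image, Finset.mem_filter, Finset.mem_univ, true_and,
      Prod.exists] at hx hx'
    obtain ⟨i, j, hij, rfl⟩ := hx
    obtain ⟨k, l, hkl, h⟩ := hx'
    have h1 := congrFun h j
    simp only [Pi.add_apply, Pi.sub_apply, Pi.single_apply] at h1
    grind
  rw [positiveRootsD, Finset.sum_union hdisj, sum_positiveRootsA,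
    Finset.sum_image (by simpa using injOn_add_single n), ← sum_filter_lt_eq_pairSum negEdge_comm,
    ← sum_filter_lt_eq_pairSum signedEdge_comm, ← Finset.sum_add_distrib]
  rfl

/-- Separates the roots of type D from the vectors `2 e_i`, so that the union defining type C is
disjoint. -/
theorem apply_le_one_of_mem_positiveRootsD {n : ℕ} {x : Fin n → ℤ} (hx : x ∈ positiveRootsD n)
    (m : Fin n) : x m ≤ 1 := by
  simp only [positiveRootsD, positiveRootsA, Finset.mem_union, Finset.mem_image, Finset.mem_filter,
    Finset.mem_univ, true_and, Prod.exists] at hx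
  rcases hx with ⟨i, j, hij, rfl⟩ | ⟨i, j, hij, rfl⟩ <;>
    simp only [Pi.add_apply, Pi.sub_apply, Pi.single_apply] <;> grind

/-- Parity of the coordinate sum separates the roots of type D from the vectors `e_i` of type B. -/
theorem even_sum_of_mem_positiveRootsD {n : ℕ} {x : Fin n → ℤ} (hx : x ∈ positiveRootsD n) :
    Even (∑ m, x m) := by
  simp only [positiveRootsD, positiveRootsA, Finset.mem_union, Finset.mem_image, Finset.mem_filter,
    Finset.mem_univ, true_and, Prod.exists] at hx
  rcases hx with ⟨i, j, hij, rfl⟩ | ⟨i, j, hij, rfl⟩ <;>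
    simp [Finset.sum_add_distrib]

theorem sum_positiveRootsB (n : ℕ) :
    ∑ α ∈ positiveRootsB n, seg α =
      pairSum signedEdge Finset.univ + ∑ i : Fin n, halfEdge i := by
  have hdisj : Disjoint (positiveRootsD n)
      ((Finset.univ : Finset (Fin n)).image fun i => Pi.single i 1) := by
    rw [Finset.disjoint_left]
    intro x hx hx'
    obtain ⟨i, -, rfl⟩ := Finset.mem_image.1 hx'
    have := even_sum_of_mem_positiveRootsD hx
    simp at this
  rw [positiveRootsB, Finset.sum_union hdisj, sum_positiveRootsD, Finset.sum_image]
  · rfl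
  · intro i _ j _ h
    have := congrFun h i
    simp only [Pi.single_apply] at this
    grind

theorem sum_positiveRootsC (n : ℕ) :
    ∑ α ∈ positiveRootsC n, seg α =
      pairSum signedEdge Finset.univ + 2 • ∑ i : Fin n, halfEdge i := by
  have hdisj : Disjoint (positiveRootsD n)
      ((Finset.univ : Finset (Fin n)).image fun i => Pi.single i 2) := by
    rw [Finset.disjoint_left]
    intro x hx hx'
    obtain ⟨i, -, rfl⟩ := Finset.mem_image.1 hx'
    have := apply_le_one_of_mem_positiveRootsD hx i
    simp at this
  rw [positiveRootsC, Finset.sum_union hdisj, sum_positiveRootsD, Finset.sum_image,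
    Finset.smul_sum]
  · congr 1
    refine Finset.sum_congr rfl fun i _ => ?_
    rw [halfEdge, ← seg_two_smul, basisVec]
    congr 1
    ext j
    simp [Pi.single_apply]
  · intro i _ j _ h
    have := congrFun h i
    simp only [Pi.single_apply] at this
    grind

theorem isEhrhartPolynomial_of_classCount {n : ℕ} {Φ : Finset (Fin n → ℤ)} {p : Polynomial ℚ}
    (h : ∀ t : ℕ, 0 < t → (classCount (t • ∑ α ∈ Φ, seg α) : ℚ) = p.eval (t : ℚ)) :
    IsEhrhartPolynomial (integralCoxeterPermutahedron Φ) p := fun t ht => by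
  obtain ⟨h1, h2⟩ := dilateLatticePoints_finite_and_ncard Φ t
  exact ⟨h1, by rw [h2, h t ht]⟩

theorem classCount_positiveRootsA {t : ℕ} {F : ℕ → ℕ → ℚ} (hF : IsTypeARecursion t F) (n : ℕ) :
    (classCount (t • ∑ α ∈ positiveRootsA n, seg α) : ℚ) = F n 0 := by
  rw [sum_positiveRootsA, (hF.classCount_eq n (Finset.univ : Finset (Fin n)) (by simp)).1]

theorem classCount_positiveRootsB {t : ℕ} {M : ℕ → ℚ → ℚ} {N : ℕ → ℕ → ℚ → ℚ}
    (hF : IsTypeBRecursion t M N) (n : ℕ) :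
    (classCount (t • ∑ α ∈ positiveRootsB n, seg α) : ℚ) = M n t := by
  rw [sum_positiveRootsB, smul_add]
  exact (hF.classCount_eq n (Finset.univ : Finset (Fin n)) (by simp)).1 t

theorem classCount_positiveRootsC {t : ℕ} {M : ℕ → ℚ → ℚ} {N : ℕ → ℕ → ℚ → ℚ}
    (hF : IsTypeBRecursion t M N) (n : ℕ) :
    (classCount (t • ∑ α ∈ positiveRootsC n, seg α) : ℚ) = M n (2 * t) := by
  rw [sum_positiveRootsC, smul_add, smul_smul, mul_comm t]
  have := (hF.classCount_eq n (Finset.univ : Finset (Fin n)) (by simp)).1 (2 * t)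
  push_cast at this
  exact this

theorem classCount_positiveRootsD {t : ℕ} {M : ℕ → ℚ → ℚ} {N : ℕ → ℕ → ℚ → ℚ}
    (hF : IsTypeBRecursion t M N) (n : ℕ) :
    (classCount (t • ∑ α ∈ positiveRootsD n, seg α) : ℚ) = M n 0 := by
  rw [sum_positiveRootsD]
  have := (hF.classCount_eq n (Finset.univ : Finset (Fin n)) (by simp)).1 0
  rw [typeBClass, zero_smul, add_zero] at this
  exact_mod_cast this

/-! ## Exponentials of power series -/

open PowerSeries in
theorem hasSubst_of_constantCoeff {f : PowerSeries ℚ} (hf : constantCoeff f = 0) : HasSubst f :=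
  HasSubst.of_constantCoeff_zero' hf

section ExpSeries

open PowerSeries

theorem constantCoeff_subst_eq {f y : PowerSeries ℚ} (hy : constantCoeff y = 0) :
    constantCoeff (f.subst y) = constantCoeff f := by
  have h := constantCoeff_subst_eq_zero (f := f - C (constantCoeff f)) hy (by simp)
  rw [subst_sub (hasSubst_of_constantCoeff hy), subst_C] at h
  change constantCoeff (f.subst y - C (constantCoeff f)) = 0 at h
  rw [map_sub, constantCoeff_C, sub_eq_zero] at h
  exact h

theorem constantCoeff_expSeries {f : PowerSeries ℚ} (hf : constantCoeff f = 0) :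
    constantCoeff (expSeries f) = 1 := by
  rw [expSeries, constantCoeff_subst_eq hf, constantCoeff_exp]

theorem derivative_expSeries {f : PowerSeries ℚ} (hf : constantCoeff f = 0) :
    d⁄dX ℚ (expSeries f) = expSeries f * d⁄dX ℚ f := by
  rw [expSeries, derivative_subst (hasSubst_of_constantCoeff hf), derivative_exp]

theorem expSeries_mul_expSeries_neg {f : PowerSeries ℚ} (hf : constantCoeff f = 0) :
    expSeries f * expSeries (-f) = 1 := by
  have hf' : constantCoeff (-f) = 0 := by rw [map_neg, hf, neg_zero]
  refine derivative.ext ?_ ?_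
  · rw [Derivation.leibniz, derivative_expSeries hf, derivative_expSeries hf', map_neg,
      derivative_one]
    simp only [smul_eq_mul]
    ring
  · rw [map_mul, constantCoeff_expSeries hf, constantCoeff_expSeries hf']
    simp

/-- By the differential equation `y exp(-f)` has derivative 0, and its constant term is 1. -/
theorem eq_expSeries_of_derivative {f y : PowerSeries ℚ} (hf : constantCoeff f = 0)
    (hy : constantCoeff y = 1) (h : d⁄dX ℚ y = y * d⁄dX ℚ f) : y = expSeries f := by
  have hf' : constantCoeff (-f) = 0 := by rw [map_neg, hf, neg_zero]
  have key : y * expSeries (-f) = 1 := by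
    refine derivative.ext ?_ ?_
    · rw [Derivation.leibniz, h, derivative_expSeries hf', map_neg, derivative_one]
      simp only [smul_eq_mul]
      ring
    · rw [map_mul, hy, constantCoeff_expSeries hf']
      simp
  linear_combination (-y) * expSeries_mul_expSeries_neg hf + expSeries f * key

theorem expSeries_add {f g : PowerSeries ℚ} (hf : constantCoeff f = 0)
    (hg : constantCoeff g = 0) : expSeries (f + g) = expSeries f * expSeries g := by
  symm
  refine eq_expSeries_of_derivative (by rw [map_add, hf, hg, add_zero]) ?_ ?_
  · rw [map_mul, constantCoeff_expSeries hf, constantCoeff_expSeries hg, mul_one]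
  · rw [Derivation.leibniz, derivative_expSeries hf, derivative_expSeries hg, map_add]
    simp only [smul_eq_mul]
    ring

theorem expSeries_zero : expSeries 0 = 1 := by
  symm
  exact eq_expSeries_of_derivative (map_zero _) (map_one _) (by simp)

theorem expSeries_natCast_mul {f : PowerSeries ℚ} (hf : constantCoeff f = 0) (k : ℕ) :
    expSeries (k * f) = expSeries f ^ k := by
  induction k with
  | zero => simp [expSeries_zero]
  | succ k ih =>
    rw [Nat.cast_succ, add_one_mul, expSeries_add (by simp [hf]) hf, ih, pow_succ]

theorem rescale_expSeries (c : ℚ) {f : PowerSeries ℚ} (hf : constantCoeff f = 0) :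
    rescale c (expSeries f) = expSeries (rescale c f) := by
  rw [expSeries, expSeries, rescale_eq_subst, rescale_eq_subst,
    subst_comp_subst_apply (hasSubst_of_constantCoeff hf) (HasSubst.smul_X' c)]

/-! ## Coefficients of exponential generating functions -/

/-- The coefficient of `x ^ m / m!`. -/
noncomputable def egfCoeff (m : ℕ) (F : PowerSeries ℚ) : ℚ := (m ! : ℚ) * coeff m F

theorem egfCoeff_add (m : ℕ) (F G : PowerSeries ℚ) :
    egfCoeff m (F + G) = egfCoeff m F + egfCoeff m G := by
  rw [egfCoeff, map_add, mul_add]; rfl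

theorem egfCoeff_C_mul (m : ℕ) (c : ℚ) (F : PowerSeries ℚ) :
    egfCoeff m (C c * F) = c * egfCoeff m F := by
  rw [egfCoeff, coeff_C_mul, egfCoeff, mul_left_comm]

theorem egfCoeff_zero_index (F : PowerSeries ℚ) : egfCoeff 0 F = constantCoeff F := by
  simp [egfCoeff]

theorem egfCoeff_succ (m : ℕ) (F : PowerSeries ℚ) :
    egfCoeff (m + 1) F = egfCoeff m (d⁄dX ℚ F) := by
  rw [egfCoeff, egfCoeff, coeff_derivative, Nat.factorial_succ]
  push_cast
  ring

/-- The `k`-th power of `c x u` is divisible by `x ^ k`, so only finitely many terms of the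
substitution matter for a given coefficient. -/
theorem X_pow_dvd_subst_sub (f u : PowerSeries ℚ) (c : ℚ) (m : ℕ) :
    X ^ (m + 1) ∣ f.subst (C c * X * u) -
      ∑ k ∈ Finset.range (m + 1), C (coeff k f) * (C c * X * u) ^ k := by
  have hy : HasSubst (C c * X * u) := hasSubst_of_constantCoeff (by simp)
  have hpow : ∀ k j, j < k → coeff j ((C c * X * u) ^ k) = 0 := by
    intro k j hjk
    rw [mul_right_comm, mul_pow, coeff_mul_X_pow', if_neg hjk.not_ge]
  rw [X_pow_dvd_iff]
  intro j hj
  rw [map_sub, sub_eq_zero, coeff_subst' hy, map_sum, finsum_eq_sum_of_support_subset]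
  · refine Finset.sum_congr rfl fun k _ => ?_
    rw [coeff_C_mul, smul_eq_mul]
  · intro k hk
    rw [Finset.coe_range, Set.mem_Iio]
    by_contra hlt
    exact hk (by simp only [hpow k j (by omega), smul_zero])

theorem egfCoeff_subst_mul (f u G : PowerSeries ℚ) (c : ℚ) (m : ℕ) :
    egfCoeff m (f.subst (C c * X * u) * G) =
      ∑ k ∈ Finset.range (m + 1), (m.choose k : ℚ) *
        (c ^ k * (egfCoeff k f * egfCoeff (m - k) (u ^ k * G))) := by
  have h := (X_pow_dvd_subst_sub f u c m).mul_right G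
  rw [X_pow_dvd_iff] at h
  have h' := h m (Nat.lt_succ_self m)
  rw [sub_mul, map_sub, sub_eq_zero] at h'
  rw [egfCoeff, h', Finset.sum_mul, map_sum, Finset.mul_sum]
  refine Finset.sum_congr rfl fun k hk => ?_
  have hkm : k ≤ m := Nat.lt_succ_iff.1 (Finset.mem_range.1 hk)
  have hre : C (coeff k f) * (C c * X * u) ^ k * G =
      C (coeff k f * c ^ k) * (X ^ k * (u ^ k * G)) := by
    rw [map_mul, map_pow]; ring
  rw [hre, coeff_C_mul, coeff_X_pow_mul', if_pos hkm, egfCoeff, egfCoeff,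
    ← Nat.choose_mul_factorial_mul_factorial hkm]
  push_cast
  ring

theorem egfCoeff_exp (k : ℕ) : egfCoeff k (exp ℚ) = 1 := by
  rw [egfCoeff, coeff_exp]
  simp [Nat.factorial_ne_zero]

theorem egfCoeff_X_mul (k : ℕ) (F : PowerSeries ℚ) :
    egfCoeff k (X * F) = k * egfCoeff (k - 1) F := by
  cases k with
  | zero => simp [egfCoeff]
  | succ k =>
    rw [egfCoeff, coeff_succ_X_mul, egfCoeff, Nat.factorial_succ, Nat.add_sub_cancel]
    push_cast
    ring

/-- The egf version of `∑ₖ (A + k B + k (k - 1) D) y ^ k / k! = exp(y) (A + y B + y ^ 2 D)`. -/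
theorem egfCoeff_expSeries_mul (u A B D G : PowerSeries ℚ) (c : ℚ) (m : ℕ) :
    egfCoeff m (expSeries (C c * X * u) *
        (A + C c * X * u * B + (C c * X * u) ^ 2 * D) * G) =
      ∑ k ∈ Finset.range (m + 1), (m.choose k : ℚ) * (c ^ k *
        egfCoeff (m - k) (u ^ k * (A + C (k : ℚ) * B + C ((k : ℚ) * (k - 1)) * D) * G)) := by
  set y := C c * X * u with hy
  have hs : HasSubst y := hasSubst_of_constantCoeff (by simp [hy])
  have h1 : (X * exp ℚ).subst y = y * expSeries y := by
    rw [subst_mul hs, subst_X hs]; rfl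
  have h2 : (X * (X * exp ℚ)).subst y = y ^ 2 * expSeries y := by
    rw [subst_mul hs, h1, subst_X hs]; ring
  have hsplit : expSeries y * (A + y * B + y ^ 2 * D) * G =
      (exp ℚ).subst y * (A * G) + (X * exp ℚ).subst y * (B * G) +
        (X * (X * exp ℚ)).subst y * (D * G) := by
    rw [h1, h2, expSeries]; ring
  rw [hsplit, egfCoeff_add, egfCoeff_add, egfCoeff_subst_mul, egfCoeff_subst_mul,
    egfCoeff_subst_mul, ← Finset.sum_add_distrib, ← Finset.sum_add_distrib]
  refine Finset.sum_congr rfl fun k _ => ?_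
  have hG : u ^ k * (A + C (k : ℚ) * B + C ((k : ℚ) * (k - 1)) * D) * G =
      u ^ k * (A * G) + C (k : ℚ) * (u ^ k * (B * G)) +
        C ((k : ℚ) * (k - 1)) * (u ^ k * (D * G)) := by ring
  rw [hG, egfCoeff_add, egfCoeff_add, egfCoeff_C_mul, egfCoeff_C_mul, egfCoeff_X_mul,
    egfCoeff_X_mul, egfCoeff_X_mul]
  simp only [egfCoeff_exp]
  rcases k with _ | k
  · simp
  · push_cast
    ring

/-! ## The functional equation of the Lambert function -/

/-- `T` is the compositional inverse of `x exp(-x)`. -/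
theorem exists_treeSeries : ∃ T : PowerSeries ℚ, constantCoeff T = 0 ∧ T = X * expSeries T := by
  have hX : constantCoeff (X : PowerSeries ℚ) = 0 := constantCoeff_X
  have hX' : constantCoeff (-X : PowerSeries ℚ) = 0 := by simp
  set P : PowerSeries ℚ := X * expSeries (-X) with hP
  have h1 : coeff 1 P = 1 := by
    rw [hP, coeff_succ_X_mul, coeff_zero_eq_constantCoeff_apply, constantCoeff_expSeries hX']
  let _ : Invertible (coeff 1 P) := by rw [h1]; exact invertibleOne
  have hP0 : constantCoeff P = 0 := by simp [hP]
  have hT0 : constantCoeff P.substInv = 0 := constantCoeff_substInv P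
  have hs := hasSubst_of_constantCoeff hT0
  refine ⟨P.substInv, hT0, ?_⟩
  have h := subst_substInv_right P hP0
  set T := P.substInv
  have h2 : P.subst T = T * expSeries (-T) := by
    rw [hP, subst_mul hs, subst_X hs]
    congr 1
    rw [expSeries, subst_comp_subst_apply (hasSubst_of_constantCoeff hX') hs, expSeries]
    congr 1
    rw [← coe_substAlgHom hs, map_neg, coe_substAlgHom hs, subst_X hs]
  have h3 := h2.symm.trans h
  linear_combination expSeries T * h3 - T * expSeries_mul_expSeries_neg hT0

/-- The numbers `a (a + m) ^ (m - 1)` of forests on `a + m` vertices with `a` specified roots. -/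
def rootedForestCount (a m : ℕ) : ℕ := if m = 0 then 1 else a * (a + m) ^ (m - 1)

theorem choose_mul_rootedForestCount {p j : ℕ} (hj : j ≤ p) :
    (p + 1).choose (j + 1) * rootedForestCount (j + 1) (p - j) =
      p.choose j * (p + 1) ^ (p - j) := by
  obtain ⟨q, rfl⟩ := Nat.exists_eq_add_of_le hj
  rw [Nat.add_sub_cancel_left, rootedForestCount]
  rcases q with _ | q
  · simp
  · rw [if_neg (Nat.succ_ne_zero q), Nat.add_sub_cancel, pow_succ',
      show j + 1 + (q + 1) = j + (q + 1) + 1 by ring]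
    have := Nat.add_one_mul_choose_eq (j + (q + 1)) j
    rw [← mul_assoc, ← this]
    ring

/-- Combinatorially, `k` is the number of vertices adjacent to the roots. Algebraically, for `m = p
+ 1` it is the binomial expansion of `(a + (p + 1)) ^ p` after an index shift `k = j + 1`. -/
theorem rootedForestCount_eq_sum (a m : ℕ) : rootedForestCount a m =
    ∑ k ∈ Finset.range (m + 1), m.choose k * (a ^ k * rootedForestCount k (m - k)) := by
  rcases m with _ | p
  · simp [rootedForestCount]
  · rw [Finset.sum_range_succ']
    have h0 : (p + 1).choose 0 * (a ^ 0 * rootedForestCount 0 (p + 1 - 0)) = 0 := by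
      simp [rootedForestCount]
    rw [h0, add_zero, rootedForestCount, if_neg (Nat.succ_ne_zero p), Nat.add_sub_cancel,
      add_pow, Finset.mul_sum]
    refine Finset.sum_congr rfl fun j hj => ?_
    rw [Nat.add_sub_add_right, mul_left_comm ((p + 1).choose _), choose_mul_rootedForestCount
      (Nat.lt_succ_iff.1 (Finset.mem_range.1 hj)), pow_succ, Nat.cast_id]
    ring

/-- Writing `exp(a T) = exp(a x exp(T))` and extracting coefficients gives the recursion
`rootedForestCount_eq_sum`. -/
theorem egfCoeff_expSeries_treeSeries {T : PowerSeries ℚ} (hT0 : constantCoeff T = 0)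
    (hT : T = X * expSeries T) (m a : ℕ) :
    egfCoeff m (expSeries T ^ a) = rootedForestCount a m := by
  induction m using Nat.strong_induction_on generalizing a with
  | _ m ih =>
  rcases Nat.eq_zero_or_pos a with rfl | ha
  · rw [pow_zero, egfCoeff, coeff_one, rootedForestCount]
    split_ifs with h <;> simp [h]
  have hexp : expSeries T ^ a = expSeries (C (a : ℚ) * X * expSeries T) * (1 : PowerSeries ℚ) := by
    rw [mul_assoc, ← hT, mul_one, map_natCast, expSeries_natCast_mul hT0]
  rw [hexp, expSeries, egfCoeff_subst_mul, rootedForestCount_eq_sum a m]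
  push_cast
  refine Finset.sum_congr rfl fun k hk => ?_
  rw [egfCoeff_exp, one_mul, mul_one]
  rcases Nat.eq_zero_or_pos k with rfl | hk0
  · rw [pow_zero (expSeries T), egfCoeff, coeff_one, rootedForestCount, Nat.sub_zero]
    split_ifs with h <;> simp [h]
  · rcases Nat.eq_zero_or_pos m with rfl | hm
    · simp at hk; omega
    · rw [ih (m - k) (by omega)]

theorem treeSeries_eq {T : PowerSeries ℚ} (hT0 : constantCoeff T = 0)
    (hT : T = X * expSeries T) : T = -rescale (-1) lambertW := by
  ext m
  rw [map_neg, coeff_rescale, lambertW, coeff_mk]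
  rcases m with _ | m
  · simpa using hT0
  · have h := egfCoeff_expSeries_treeSeries hT0 hT m 1
    rw [pow_one, egfCoeff] at h
    have hf : (m ! : ℚ) ≠ 0 := by exact_mod_cast Nat.factorial_ne_zero m
    rw [hT, coeff_succ_X_mul, if_neg (Nat.succ_ne_zero m), Nat.add_sub_cancel,
      eq_div_of_mul_eq hf ((mul_comm _ _).trans h), Nat.factorial_succ, rootedForestCount,
      neg_pow ((m + 1 : ℕ) : ℚ)]
    have hs : (-1 : ℚ) ^ (m + 1) * (-1) ^ m = -1 := by
      rw [pow_succ, mul_right_comm, ← mul_pow]; simp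
    have hm : ((m : ℚ) + 1) ≠ 0 := by positivity
    rcases m with _ | m
    · simp
    · rw [if_neg (Nat.succ_ne_zero m)]
      push_cast at hm ⊢
      rw [← neg_eq_iff_eq_neg, ← mul_div_assoc, ← mul_assoc, hs]
      field_simp
      ring

theorem constantCoeff_lambertWScaled (c : ℚ) : constantCoeff (lambertWScaled c) = 0 := by
  simp [lambertWScaled, lambertW, ← coeff_zero_eq_constantCoeff_apply, coeff_rescale]

theorem neg_lambertWScaled_eq (c : ℚ) :
    -lambertWScaled (-c) = C c * X * expSeries (-lambertWScaled (-c)) := by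
  obtain ⟨T, hT0, hT⟩ := exists_treeSeries
  have h : -lambertWScaled (-c) = rescale c T := by
    rw [treeSeries_eq hT0 hT, map_neg, rescale_rescale, lambertWScaled]
    simp
  rw [h, ← rescale_expSeries c hT0]
  conv_lhs => rw [hT, map_mul, rescale_X]

end ExpSeries

/-! ## The generating functions satisfy the recursions -/

section GeneratingFunctions

open PowerSeries

theorem derivative_tree_equation {c : ℚ} {w : PowerSeries ℚ} (hw0 : constantCoeff w = 0)
    (hw : w = C c * X * expSeries w) : (1 - w) * d⁄dX ℚ w = C c * expSeries w := by
  have h : d⁄dX ℚ w = C c * expSeries w + C c * X * (expSeries w * d⁄dX ℚ w) := by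
    conv_lhs => rw [hw]
    rw [Derivation.leibniz, Derivation.leibniz, derivative_C, derivative_X,
      derivative_expSeries hw0]
    simp only [smul_eq_mul]
    ring
  linear_combination h - d⁄dX ℚ w * hw

/-- The exponential generating function in type `A`, in terms of the solution `w` of
`w = t x exp(w)`. -/
noncomputable def typeASeries (t : ℚ) (w : PowerSeries ℚ) : PowerSeries ℚ :=
  expSeries (C (1 / t) * w - C (1 / (2 * t)) * w ^ 2)

theorem constantCoeff_typeASeries (t : ℚ) {w : PowerSeries ℚ} (hw0 : constantCoeff w = 0) :
    constantCoeff (typeASeries t w) = 1 :=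
  constantCoeff_expSeries (by simp [hw0])

/-- The exponent has derivative `(1 - w) w' / t`, which is `exp(w)` by `derivative_tree_equation`.
-/
theorem derivative_typeASeries {t : ℚ} (ht : t ≠ 0) {w : PowerSeries ℚ}
    (hw0 : constantCoeff w = 0) (hw : w = C t * X * expSeries w) :
    d⁄dX ℚ (typeASeries t w) = expSeries w * typeASeries t w := by
  rw [typeASeries, derivative_expSeries (by simp [hw0]), map_sub, Derivation.leibniz,
    Derivation.leibniz, derivative_C, derivative_C, derivative_pow]
  simp only [smul_eq_mul]
  have h := derivative_tree_equation hw0 hw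
  have h1 : C (1 / t) * C t = (1 : PowerSeries ℚ) := by
    rw [← map_mul, one_div_mul_cancel ht, map_one]
  have h2 : C (1 / (2 * t)) * 2 = (C (1 / t) : PowerSeries ℚ) := by
    rw [show (2 : PowerSeries ℚ) = C 2 from (map_ofNat C 2).symm, ← map_mul]
    congr 1
    field_simp
  push_cast
  linear_combination expSeries (C (1 / t) * w - C (1 / (2 * t)) * w ^ 2) *
    (C (1 / t) * h + expSeries w * h1 - w * d⁄dX ℚ w * h2)

/-- The star relation is `exp(a w) = exp(a t x exp(w))` read coefficientwise; the passage to one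
more vertex is the differential equation for `typeASeries`. -/
theorem isTypeARecursion_typeASeries {t : ℚ} (ht : t ≠ 0) {w : PowerSeries ℚ}
    (hw0 : constantCoeff w = 0) (hw : w = C t * X * expSeries w) :
    IsTypeARecursion t fun m a => egfCoeff m (expSeries w ^ a * typeASeries t w) where
  zero := by rw [egfCoeff_zero_index, pow_zero, one_mul, constantCoeff_typeASeries t hw0]
  succ m := by
    rw [egfCoeff_succ, pow_zero, one_mul, derivative_typeASeries ht hw0 hw, pow_one]
  star m a := by
    have h := egfCoeff_expSeries_mul (expSeries w) 1 0 0 (typeASeries t w) (a * t) m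
    simp only [mul_zero, add_zero, mul_one] at h
    rw [← h, ← expSeries_natCast_mul hw0, map_mul, map_natCast]
    congr 3
    linear_combination (a : PowerSeries ℚ) * hw

/-- The exponential generating function in types `B`, `C`, `D`, with `h` half edges at each vertex,
in terms of the solution `w` of `w = 2 t x exp(w)`. -/
noncomputable def typeBSeries (t h : ℚ) (w : PowerSeries ℚ) : PowerSeries ℚ :=
  expSeries (C ((1 + h - t) / (2 * t)) * w - C (1 / (4 * t)) * w ^ 2) * (sqrtOneAdd (-w))⁻¹

theorem constantCoeff_sqrtOneAdd {f : PowerSeries ℚ} (hf : constantCoeff f = 0) :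
    constantCoeff (sqrtOneAdd f) = 1 := by
  rw [sqrtOneAdd, constantCoeff_subst_eq hf, ← coeff_zero_eq_constantCoeff_apply,
    binomialSeries_coeff]
  simp

theorem constantCoeff_typeBSeries (t h : ℚ) {w : PowerSeries ℚ} (hw0 : constantCoeff w = 0) :
    constantCoeff (typeBSeries t h w) = 1 := by
  rw [typeBSeries, map_mul, constantCoeff_expSeries (by simp [hw0]), constantCoeff_inv,
    constantCoeff_sqrtOneAdd (by simp [hw0])]
  simp

/-- The parameter `h` enters only through `exp(h w / (2 t))`. -/
theorem typeBSeries_add {t : ℚ} (ht : t ≠ 0) (h : ℚ) (k : ℕ) {w : PowerSeries ℚ}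
    (hw0 : constantCoeff w = 0) :
    typeBSeries t (h + 2 * (k * t)) w = expSeries w ^ k * typeBSeries t h w := by
  rw [typeBSeries, typeBSeries, ← mul_assoc (expSeries w ^ k), ← expSeries_natCast_mul hw0,
    ← expSeries_add (by simp [hw0]) (by simp [hw0])]
  congr 2
  have : (1 + (h + 2 * (k * t)) - t) / (2 * t) = k + (1 + h - t) / (2 * t) := by
    field_simp; ring
  rw [this, map_add, map_natCast]
  ring

theorem derivative_inv_sqrtOneAdd_neg {w v : PowerSeries ℚ} (hw0 : constantCoeff w = 0)
    (hv : v * (1 - w) = 1) :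
    2 * d⁄dX ℚ (sqrtOneAdd (-w))⁻¹ = v * d⁄dX ℚ w * (sqrtOneAdd (-w))⁻¹ := by
  have hw0' : constantCoeff (-w) = 0 := by rw [map_neg, hw0, neg_zero]
  set r := sqrtOneAdd (-w) with hr
  have hr0 : constantCoeff r ≠ 0 := by rw [hr, constantCoeff_sqrtOneAdd hw0']; exact one_ne_zero
  have hsq : r ^ 2 = 1 - w := by rw [hr, sqrtOneAdd_sq _ hw0']; ring
  have hinv : r * r⁻¹ = 1 := PowerSeries.mul_inv_cancel r hr0
  have hd : 2 * r * d⁄dX ℚ r = -d⁄dX ℚ w := by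
    have := congrArg (d⁄dX ℚ) hsq
    rw [derivative_pow, map_sub, derivative_one] at this
    push_cast at this
    linear_combination this
  have hv' : r⁻¹ ^ 2 = v := by
    linear_combination (-r⁻¹ ^ 2) * hv + v * r⁻¹ ^ 2 * hsq.symm + v * (r * r⁻¹ + 1) * hinv
  rw [derivative_inv', hv']
  linear_combination 2 * v * d⁄dX ℚ r * hinv - v * r⁻¹ * hd

/-- The power series counting ways to attach a cycle or a half edge to the component of a vertex. -/
structure IsTypeBCoefficients (t h : ℚ) (w v α β : PowerSeries ℚ) : Prop where
  inv : v * (1 - w) = 1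
  quad : β = C t * w * v
  lin : α = w * v * (C h + β)

/-- With `w' = 2 t exp(w) v`, the logarithmic derivative is `exp(w) (1 + h v + t w v²)`; since `v =
1 + w v`, this is `exp(w) (1 + h + α + β)`. -/
theorem derivative_typeBSeries {t h : ℚ} (ht : t ≠ 0) {w v α β : PowerSeries ℚ}
    (hw0 : constantCoeff w = 0) (hw : w = C (2 * t) * X * expSeries w)
    (hc : IsTypeBCoefficients t h w v α β) :
    d⁄dX ℚ (typeBSeries t h w) =
      expSeries w * typeBSeries t h w * (1 + C h + α + β) := by
  have h2 : (2 : PowerSeries ℚ) = C 2 := (map_ofNat C 2).symm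
  have hr := derivative_inv_sqrtOneAdd_neg hw0 hc.inv
  have hD := derivative_tree_equation hw0 hw
  have hv := hc.inv
  rw [typeBSeries, Derivation.leibniz, derivative_expSeries (by simp [hw0]), map_sub,
    Derivation.leibniz, Derivation.leibniz, derivative_C, derivative_C, derivative_pow]
  simp only [smul_eq_mul]
  set R := (sqrtOneAdd (-w))⁻¹
  set E := expSeries (C ((1 + h - t) / (2 * t)) * w - C (1 / (4 * t)) * w ^ 2)
  set u := expSeries w
  have hw' : d⁄dX ℚ w = C (2 * t) * u * v := by
    linear_combination v * hD - d⁄dX ℚ w * hv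
  have h1 : C ((1 + h - t) / (2 * t)) * C (2 * t) = (1 + C h - C t : PowerSeries ℚ) := by
    rw [← map_mul, div_mul_cancel₀ _ (by simpa using ht), map_sub, map_add, map_one]
  have h3 : 2 * C (1 / (4 * t)) * C (2 * t) = (1 : PowerSeries ℚ) := by
    rw [h2, ← map_mul, ← map_mul, ← map_one C]
    congr 1
    field_simp
    norm_num
  have hr' : d⁄dX ℚ R = C t * u * v ^ 2 * R := by
    rw [hw', map_mul, ← h2] at hr
    have : (2 : PowerSeries ℚ) ≠ 0 := fun h => by
      simpa using congrArg constantCoeff (h2.symm.trans h)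
    apply mul_left_cancel₀ this
    linear_combination hr
  rw [hr', hw', hc.lin, hc.quad]
  push_cast
  linear_combination E * R * u * v * h1 - E * R * u * v * w * h3 +
    E * R * u * (1 + C h + C t * v + C t * w * v) * hv

theorem isTypeBRecursion_typeBSeries {t : ℚ} (ht : t ≠ 0) {w v β : PowerSeries ℚ}
    {α : ℚ → PowerSeries ℚ} (hw0 : constantCoeff w = 0) (hw : w = C (2 * t) * X * expSeries w)
    (hc : ∀ h, IsTypeBCoefficients t h w v (α h) β) :
    IsTypeBRecursion t (fun m h => egfCoeff m (typeBSeries t h w))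
      fun m a h => egfCoeff m (expSeries w ^ a *
        (1 + C (a : ℚ) * α h + C ((a : ℚ) ^ 2) * β) * typeBSeries t h w) where
  zero h := by rw [egfCoeff_zero_index, constantCoeff_typeBSeries t h hw0]
  isolated m h := by simp
  succ m h := by
    have h1 := typeBSeries_add ht h 1 hw0
    rw [Nat.cast_one, one_mul, pow_one] at h1
    rw [egfCoeff_succ, derivative_typeBSeries ht hw0 hw (hc h), h1, ← egfCoeff_C_mul,
      ← egfCoeff_add]
    congr 1
    simp only [Nat.cast_one, one_pow, map_one]
    ring
  star m a h := by
    set u := expSeries w with hu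
    set M := typeBSeries t h w with hM
    set y := C (a * t) * X * u with hy
    have h2 : (2 : PowerSeries ℚ) = C 2 := (map_ofNat C 2).symm
    have hy2 : 2 * y = C (a : ℚ) * w := by
      conv_rhs => rw [hw]
      rw [hy, map_mul, map_mul, ← h2]
      ring
    -- The summand is rewritten in the basis `1, l, l (l - 1)`, the form in which
    -- `egfCoeff_expSeries_mul` performs the sum over `l`.
    have hinner : ∀ k l : ℕ, ∀ j,
        egfCoeff j (u ^ (k + l) * (1 + C ((k + l : ℕ) : ℚ) * α h + C (((k + l : ℕ) : ℚ) ^ 2) * β) * M)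
          + (t * ((k + l) * (k + l - 1)) + h * (k + l) + 2 * (a * t) * k) *
            egfCoeff j (typeBSeries t (h + 2 * ((k + l) * t)) w) =
        egfCoeff j (u ^ l * ((1 + C (k : ℚ) * α h + C ((k : ℚ) ^ 2) * β +
            C (t * (k * (k - 1)) + h * k + 2 * (a * t) * k)) +
          C (l : ℚ) * (α h + C (2 * k + 1 : ℚ) * β + C (2 * t * k + h)) +
          C ((l : ℚ) * (l - 1)) * (β + C t)) * (u ^ k * M)) := by
      intro k l j
      have h1 := typeBSeries_add ht h (k + l) hw0
      rw [Nat.cast_add] at h1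
      rw [h1, ← egfCoeff_C_mul, ← egfCoeff_add]
      congr 1
      simp only [map_add, map_mul, map_sub, map_pow, map_one, Nat.cast_add, ← h2]
      ring
    -- The result of the inner sum is again quadratic in `k`, so the same lemma performs the outer
    -- sum.
    have houter : ∀ k : ℕ, ∀ j,
        egfCoeff j (expSeries y * ((1 + C (k : ℚ) * α h + C ((k : ℚ) ^ 2) * β +
            C (t * (k * (k - 1)) + h * k + 2 * (a * t) * k)) +
          y * (α h + C (2 * k + 1 : ℚ) * β + C (2 * t * k + h)) +
          y ^ 2 * (β + C t)) * (u ^ k * M)) =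
        egfCoeff j (u ^ k * ((1 + y * (α h + β + C h) + y ^ 2 * (β + C t)) +
          C (k : ℚ) * (α h + β + C h + C (2 * (a * t)) + 2 * y * (β + C t)) +
          C ((k : ℚ) * (k - 1)) * (β + C t)) * (expSeries y * M)) := by
      intro k j
      congr 1
      simp only [map_add, map_mul, map_sub, map_pow, map_one, ← h2]
      ring
    simp only [hinner, ← egfCoeff_expSeries_mul, ← hy, houter]
    congr 1
    have hyc : constantCoeff y = 0 := by simp [hy]
    -- The two sums, over negative and positive edges, each contribute a factor `exp(y)`; the factor
    -- 2 in `w = 2 t x exp(w)` makes `2 y = a w`.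
    have hexp : u ^ a = expSeries y * expSeries y := by
      rw [hu, ← expSeries_natCast_mul hw0, ← expSeries_add hyc hyc]
      congr 1
      rw [← two_mul, hy2, map_natCast]
    -- Together with `hβ`, this is the fixed-point form of the coefficients needed to compare the
    -- linear and quadratic terms in `a`.
    have hα : α h = w * (α h + β + C h) := by
      have h3 := (hc h).lin
      linear_combination (1 - w) * h3 + w * (C h + β) * (hc h).inv
    have hβ : β = C t * w + w ^ 2 * (β + C t) := by
      have h3 := (hc h).quad
      linear_combination (1 - w ^ 2) * h3 + C t * w * (1 + w) * (hc h).inv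
    rw [hexp]
    have hat : C (2 * (a * t)) = C (a : ℚ) * C t * (2 : PowerSeries ℚ) := by
      rw [h2, ← map_mul, ← map_mul]; congr 1; ring
    rw [hat, map_pow]
    have key : 1 + C (a : ℚ) * α h + C (a : ℚ) ^ 2 * β =
        1 + 2 * y * (α h + β + C h + C (a : ℚ) * C t) + (2 * y) ^ 2 * (β + C t) := by
      rw [hy2]
      linear_combination C (a : ℚ) * hα + C (a : ℚ) ^ 2 * hβ
    linear_combination expSeries y * expSeries y * M * key

end GeneratingFunctions

/-! ## Polynomiality -/

/-- A function agreeing with a polynomial at all nonzero arguments. -/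
def IsPolynomialFun (f : ℚ → ℚ) : Prop := ∃ p : Polynomial ℚ, ∀ t, t ≠ 0 → f t = p.eval t

namespace IsPolynomialFun

theorem eval (p : Polynomial ℚ) : IsPolynomialFun fun t => p.eval t := ⟨p, fun _ _ => rfl⟩

theorem const (c : ℚ) : IsPolynomialFun fun _ => c := ⟨Polynomial.C c, by simp⟩

theorem id : IsPolynomialFun fun t => t := ⟨Polynomial.X, by simp⟩

theorem congr {f g : ℚ → ℚ} (hg : IsPolynomialFun g) (h : ∀ t, t ≠ 0 → f t = g t) :
    IsPolynomialFun f := by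
  obtain ⟨p, hp⟩ := hg
  exact ⟨p, fun t ht => (h t ht).trans (hp t ht)⟩

theorem add {f g : ℚ → ℚ} (hf : IsPolynomialFun f) (hg : IsPolynomialFun g) :
    IsPolynomialFun fun t => f t + g t := by
  obtain ⟨p, hp⟩ := hf
  obtain ⟨q, hq⟩ := hg
  exact ⟨p + q, fun t ht => by beta_reduce; rw [hp t ht, hq t ht, Polynomial.eval_add]⟩

theorem mul {f g : ℚ → ℚ} (hf : IsPolynomialFun f) (hg : IsPolynomialFun g) :
    IsPolynomialFun fun t => f t * g t := by
  obtain ⟨p, hp⟩ := hf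
  obtain ⟨q, hq⟩ := hg
  exact ⟨p * q, fun t ht => by beta_reduce; rw [hp t ht, hq t ht, Polynomial.eval_mul]⟩

theorem pow {f : ℚ → ℚ} (hf : IsPolynomialFun f) (k : ℕ) : IsPolynomialFun fun t => f t ^ k := by
  obtain ⟨p, hp⟩ := hf
  exact ⟨p ^ k, fun t ht => by beta_reduce; rw [hp t ht, Polynomial.eval_pow]⟩

theorem sum {ι : Type*} (s : Finset ι) {f : ι → ℚ → ℚ} (hf : ∀ i ∈ s, IsPolynomialFun (f i)) :
    IsPolynomialFun fun t => ∑ i ∈ s, f i t := by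
  classical
  induction s using Finset.induction_on with
  | empty => exact (const 0).congr fun _ _ => by simp
  | insert i s hi ih =>
    exact ((hf i (Finset.mem_insert_self i s)).add
      (ih fun j hj => hf j (Finset.mem_insert_of_mem hj))).congr
        fun t _ => by rw [Finset.sum_insert hi]

end IsPolynomialFun

/-- The closed form divides by `t`, so polynomiality is invisible there; the recursion uses only
sums and products. -/
theorem isPolynomialFun_of_isTypeARecursion {F : ℚ → ℕ → ℕ → ℚ}
    (hF : ∀ t, t ≠ 0 → IsTypeARecursion t (F t)) (m a : ℕ) :
    IsPolynomialFun fun t => F t m a := by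
  induction m using Nat.strong_induction_on generalizing a with
  | _ m ih =>
  have h0 : IsPolynomialFun fun t => F t m 0 := by
    rcases m with _ | m
    · exact (IsPolynomialFun.const 1).congr fun t ht => (hF t ht).zero
    · exact (ih m (Nat.lt_succ_self m) 1).congr fun t ht => (hF t ht).succ m
  refine IsPolynomialFun.congr (IsPolynomialFun.sum (Finset.range (m + 1)) fun k hk => ?_)
    fun t ht => (hF t ht).star m a
  refine (IsPolynomialFun.const _).mul
    ((((IsPolynomialFun.const _).mul IsPolynomialFun.id).pow k).mul ?_)
  rcases Nat.eq_zero_or_pos k with rfl | hpos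
  · exact h0
  · rw [Finset.mem_range] at hk
    exact ih (m - k) (by omega) k

/-- The recursion shifts `h` by multiples of `t`, so `h` has to range over polynomials in `t` for
the induction to close. -/
theorem isPolynomialFun_of_isTypeBRecursion {M : ℚ → ℕ → ℚ → ℚ} {N : ℚ → ℕ → ℕ → ℚ → ℚ}
    (hF : ∀ t, t ≠ 0 → IsTypeBRecursion t (M t) (N t)) (m : ℕ) :
    (∀ p : Polynomial ℚ, IsPolynomialFun fun t => M t m (p.eval t)) ∧
      ∀ (a : ℕ) (p : Polynomial ℚ), IsPolynomialFun fun t => N t m a (p.eval t) := by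
  open Polynomial in
  induction m using Nat.strong_induction_on with
  | _ m ih =>
  have h0 : ∀ p : ℚ[X], IsPolynomialFun fun t => M t m (p.eval t) := by
    intro p
    rcases m with _ | m
    · exact (IsPolynomialFun.const 1).congr fun t ht => (hF t ht).zero _
    · have hlt := Nat.lt_succ_self m
      refine (((ih m hlt).2 1 p).add ((IsPolynomialFun.eval p).mul
        ((ih m hlt).1 (p + C 2 * X)))).congr fun t ht => ?_
      rw [(hF t ht).succ]
      simp
  refine ⟨h0, fun a p => ?_⟩
  have hc : IsPolynomialFun fun t => a * t := (IsPolynomialFun.const _).mul IsPolynomialFun.id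
  refine IsPolynomialFun.congr (IsPolynomialFun.sum (Finset.range (m + 1)) fun k hk => ?_)
    fun t ht => (hF t ht).star m a _
  refine (IsPolynomialFun.const _).mul ((hc.pow k).mul
    (IsPolynomialFun.sum (Finset.range (m - k + 1)) fun l hl => ?_))
  rw [Finset.mem_range] at hk hl
  refine (IsPolynomialFun.const _).mul ((hc.pow l).mul (IsPolynomialFun.add ?_
    (IsPolynomialFun.mul ?_ ?_)))
  · rcases Nat.eq_zero_or_pos (k + l) with hz | hpos
    · obtain ⟨rfl, rfl⟩ := Nat.add_eq_zero_iff.1 hz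
      exact (h0 p).congr fun t ht => (hF t ht).isolated _ _
    · exact (ih (m - k - l) (by omega)).2 _ p
  · exact ((IsPolynomialFun.id.mul (IsPolynomialFun.const _)).add
      ((IsPolynomialFun.eval p).mul (IsPolynomialFun.const _))).add
        (((IsPolynomialFun.const 2).mul hc).mul (IsPolynomialFun.const _))
  · have hev : ∀ t : ℚ, p.eval t + 2 * ((k + l) * t) = (p + C (2 * (k + l : ℚ)) * X).eval t := by
      intro t
      simp only [eval_add, eval_mul, eval_C, eval_X]
      ring
    simp only [hev]
    rcases Nat.eq_zero_or_pos (k + l) with hz | hpos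
    · obtain ⟨rfl, rfl⟩ := Nat.add_eq_zero_iff.1 hz
      exact h0 _
    · exact (ih (m - k - l) (by omega)).1 _

/-! ## The main theorem -/

section Main

open PowerSeries

/-- The power series `w` with `w = t x exp(w)`. -/
noncomputable def treeArg (t : ℚ) : PowerSeries ℚ := -lambertWScaled (-t)

theorem constantCoeff_treeArg (t : ℚ) : constantCoeff (treeArg t) = 0 := by
  rw [treeArg, map_neg, constantCoeff_lambertWScaled, neg_zero]

theorem treeArg_eq (t : ℚ) : treeArg t = C t * X * expSeries (treeArg t) :=
  neg_lambertWScaled_eq t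

/-- The solution of the type `A` recursion. -/
noncomputable def typeANumber (t : ℚ) (m a : ℕ) : ℚ :=
  egfCoeff m (expSeries (treeArg t) ^ a * typeASeries t (treeArg t))

theorem isTypeARecursion_typeANumber {t : ℚ} (ht : t ≠ 0) : IsTypeARecursion t (typeANumber t) :=
  isTypeARecursion_typeASeries ht (constantCoeff_treeArg t) (treeArg_eq t)

/-- The solution of the type `B` recursion without special vertex. -/
noncomputable def typeBNumber (t : ℚ) (m : ℕ) (h : ℚ) : ℚ :=
  egfCoeff m (typeBSeries t h (treeArg (2 * t)))

theorem exists_isTypeBRecursion {t : ℚ} (ht : t ≠ 0) :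
    ∃ N, IsTypeBRecursion t (typeBNumber t) N := by
  set w := treeArg (2 * t) with hw
  have hw0 : constantCoeff w = 0 := constantCoeff_treeArg _
  have hinv : (1 - w)⁻¹ * (1 - w) = 1 := PowerSeries.inv_mul_cancel _ (by simp [hw0])
  exact ⟨_, isTypeBRecursion_typeBSeries ht (v := (1 - w)⁻¹)
    (β := C t * w * (1 - w)⁻¹) (α := fun h => w * (1 - w)⁻¹ * (C h + C t * w * (1 - w)⁻¹))
    hw0 (treeArg_eq _) fun h => ⟨hinv, rfl, rfl⟩⟩

theorem egfAt_eq_of_eval {p : ℕ → Polynomial ℚ} {t : ℚ} {F : PowerSeries ℚ}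
    (h : ∀ n, (p n).eval t = egfCoeff n F) : egfAt p t = F := by
  ext n
  have hf : (n ! : ℚ) ≠ 0 := by exact_mod_cast Nat.factorial_ne_zero n
  rw [egfAt, coeff_mk, h, egfCoeff, mul_div_cancel_left₀ _ hf]

theorem typeBSeries_treeArg {t : ℚ} (h : ℚ) :
    typeBSeries t h (treeArg (2 * t)) =
      expSeries (((t - h - 1) / (2 * t)) • lambertWScaled (-2 * t)
        - (1 / (4 * t)) • lambertWScaled (-2 * t) ^ 2)
        * (sqrtOneAdd (lambertWScaled (-2 * t)))⁻¹ := by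
  rw [typeBSeries, treeArg, neg_neg, neg_mul, smul_eq_C_mul, smul_eq_C_mul]
  congr 2
  have : (t - h - 1) / (2 * t) = -((1 + h - t) / (2 * t)) := by ring
  rw [this, map_neg]
  ring

theorem typeASeries_treeArg (t : ℚ) :
    typeASeries t (treeArg t) =
      expSeries (-(1 / t) • lambertWScaled (-t) - (1 / (2 * t)) • lambertWScaled (-t) ^ 2) := by
  rw [typeASeries, treeArg, smul_eq_C_mul, smul_eq_C_mul, map_neg]
  congr 1
  ring

end Main

theorem theorem5p2 :
    ∃ ehrA ehrB ehrC ehrD : ℕ → Polynomial ℚ,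
      (∀ n : ℕ,
        IsEhrhartPolynomial (integralCoxeterPermutahedron (positiveRootsA n)) (ehrA n) ∧
        IsEhrhartPolynomial (integralCoxeterPermutahedron (positiveRootsB n)) (ehrB n) ∧
        IsEhrhartPolynomial (integralCoxeterPermutahedron (positiveRootsC n)) (ehrC n) ∧
        IsEhrhartPolynomial (integralCoxeterPermutahedron (positiveRootsD n)) (ehrD n)) ∧
      ∀ t : ℚ, t ≠ 0 →
        egfAt ehrA t =
          expSeries (-(1 / t) • lambertWScaled (-t)
            - (1 / (2 * t)) • lambertWScaled (-t) ^ 2) ∧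
        egfAt ehrB t =
          expSeries (-(1 / (2 * t)) • lambertWScaled (-2 * t)
            - (1 / (4 * t)) • lambertWScaled (-2 * t) ^ 2)
            * (sqrtOneAdd (lambertWScaled (-2 * t)))⁻¹ ∧
        egfAt ehrC t =
          expSeries (((-t - 1) / (2 * t)) • lambertWScaled (-2 * t)
            - (1 / (4 * t)) • lambertWScaled (-2 * t) ^ 2)
            * (sqrtOneAdd (lambertWScaled (-2 * t)))⁻¹ ∧
        egfAt ehrD t =
          expSeries (((t - 1) / (2 * t)) • lambertWScaled (-2 * t)
            - (1 / (4 * t)) • lambertWScaled (-2 * t) ^ 2)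
            * (sqrtOneAdd (lambertWScaled (-2 * t)))⁻¹ := by
  choose! N hN using fun (t : ℚ) (ht : t ≠ 0) => exists_isTypeBRecursion ht
  have hpolyB (p : Polynomial ℚ) (n : ℕ) : IsPolynomialFun fun t => typeBNumber t n (p.eval t) :=
    (isPolynomialFun_of_isTypeBRecursion hN n).1 p
  choose pA hpA using fun n =>
    isPolynomialFun_of_isTypeARecursion (fun t ht => isTypeARecursion_typeANumber ht) n 0
  choose pB hpB using hpolyB
  beta_reduce at hpA hpB
  have hcast {t : ℕ} (ht : 0 < t) : (t : ℚ) ≠ 0 := by exact_mod_cast ht.ne'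
  -- The half-edge parameter `h` is `t` in type B, `2 t` in type C because `2 e_i` counts twice, and
  -- 0 in type D.
  refine ⟨pA, pB Polynomial.X, pB (Polynomial.C 2 * Polynomial.X), pB 0,
    fun n => ⟨?_, ?_, ?_, ?_⟩, fun t ht => ⟨?_, ?_, ?_, ?_⟩⟩
  · refine isEhrhartPolynomial_of_classCount fun t ht => ?_
    rw [← hpA n t (hcast ht),
      classCount_positiveRootsA (isTypeARecursion_typeANumber (hcast ht)) n]
  · refine isEhrhartPolynomial_of_classCount fun t ht => ?_
    rw [← hpB _ n t (hcast ht), classCount_positiveRootsB (hN t (hcast ht)) n, Polynomial.eval_X]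
  · refine isEhrhartPolynomial_of_classCount fun t ht => ?_
    rw [← hpB _ n t (hcast ht), classCount_positiveRootsC (hN t (hcast ht)) n]
    simp
  · refine isEhrhartPolynomial_of_classCount fun t ht => ?_
    rw [← hpB _ n t (hcast ht), classCount_positiveRootsD (hN t (hcast ht)) n,
      Polynomial.eval_zero]
  · rw [← typeASeries_treeArg]
    exact egfAt_eq_of_eval fun n => by rw [← hpA n t ht, typeANumber, pow_zero, one_mul]
  · have h : -(1 / (2 * t)) = (t - t - 1) / (2 * t) := by ring
    rw [h, ← typeBSeries_treeArg]
    exact egfAt_eq_of_eval fun n => by rw [← hpB _ n t ht, typeBNumber, Polynomial.eval_X]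
  · have h : -t - 1 = t - 2 * t - 1 := by ring
    rw [h, ← typeBSeries_treeArg]
    exact egfAt_eq_of_eval fun n => by rw [← hpB _ n t ht, typeBNumber]; simp
  · have h : t - 1 = t - 0 - 1 := by ring
    rw [h, ← typeBSeries_treeArg]
    exact egfAt_eq_of_eval fun n => by rw [← hpB _ n t ht, typeBNumber, Polynomial.eval_zero]
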